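/- **Setting.** Let $(X,\mathsf d)$ be a complete separable metric space and $\mathfrak m$ a nonnegative $\sigma$-finite Borel measure on $X$ such that $$\forall K\subset X \text{ compact}\ \ \exists\, r>0:\quad \mathfrak m(\{x\in X:\mathsf d(x,K)\le r\})<\infty. \tag{3.1}$$ For $f:X\to\mathbb R$ Lipschitz let $|Df|(x):=\limsup_{y\to x}|f(y)-f(x)|/\mathsf d(y,x)$ (and $|Df|(x):=0$ if $x$ is isolated). A function $G\in L^2(X,\mathfrak m)$ is a *relaxed gradient* of $f\in L^2(X,\mathfrak m)$ if there are Lipschitz functions $f_n\in L^2(X,\mathfrak m)$ with $|Df_n|\in L^2(X,\mathfrak m)$, and $\tilde G\in L^2(X,\mathfrak m)$, such that $f_n\to f$ strongly and $|Df_n|\rightharpoonup\tilde G$ weakly in $L^2(X,\mathfrak m)$, and $\tilde G\le G$ $\mathfrak m$-a.e. The relaxed gradient of minimal $L^2$-norm is the *minimal relaxed gradient* $|Df|_*$, and the *Cheeger energy* is $\mathsf{Ch}(f):=\frac12\int_X|Df|_*^2\,\mathrm d\mathfrak m$, with $\mathsf{Ch}(f):=+\infty$ if $f$ has no relaxed gradient.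 The subdifferential $\partial^-\mathsf{Ch}(f)$ is the set of $\ell\in L^2(X,\mathfrak m)$ with $\int_X\ell(g-f)\,\mathrm d\mathfrak m+\mathsf{Ch}(f)\le\mathsf{Ch}(g)$ for all $g\in L^2(X,\mathfrak m)$; one writes $f\in D(\Delta)$ if $f\in L^2(X,\mathfrak m)$ and $\partial^-\mathsf{Ch}(f)\ne\emptyset$, and then $\Delta f$ is its element of minimal $L^2$-norm. The *$L^2$-Liouville property* says that every $f\in D(\Delta)$ with $\Delta f=0$ is $\mathfrak m$-a.e. equal to a constant $c\in\mathbb R$. **Proposition 3.3.** For every $f\in L^2(X,\mathfrak m)$ there is a unique locally Lipschitz curve $t\mapsto H_tf$ from $(0,\infty)$ to $L^2(X,\mathfrak m)$ with $\frac{\mathrm d}{\mathrm dt}H_tf\in-\partial^-\mathsf{Ch}(H_tf)$ for a.e. $t>0$ (in particular differentiable at a.e. $t>0$) and $H_tf\to f$ in $L^2(X,\mathfrak m)$ as $t\to0^+$ (the *heat flow* starting from $f$). Moreover, the following are equivalent: 1. $(X,\mathsf d,\mathfrak m)$ satisfies the $L^2$-Liouville property. 2. Every $f\in L^2(X,\mathfrak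 m)$ with $\mathsf{Ch}(f)=0$ is $\mathfrak m$-a.e. equal to a constant $c\in\mathbb R$. 3. Every $f\in L^2(X,\mathfrak m)$ that admits a minimal relaxed gradient with $|Df|_*=0$ $\mathfrak m$-a.e. is $\mathfrak m$-a.e. equal to a constant $c\in\mathbb R$. 4. For every $f\in L^2(X,\mathfrak m)$ there is $c\in\mathbb R$ such that $H_tf\to c$ in $L^2(X,\mathfrak m)$ as $t\to\infty$. 5. Every $f\in L^2(X,\mathfrak m)$ with $H_tf=f$ $\mathfrak m$-a.e. for all $t>0$ is $\mathfrak m$-a.e. equal to a constant $c\in\mathbb R$. 6. Every $f\in L^2(X,\mathfrak m)$ for which there is some $t_0>0$ with $H_{t_0}f=f$ $\mathfrak m$-a.e. is $\mathfrak m$-a.e. equal to a constant $c\in\mathbb R$. -/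

import Mathlib

open MeasureTheory Filter Set Topology
open scoped ENNReal NNReal

noncomputable section

namespace MetricMeasure

variable {X : Type*} [MetricSpace X]

/-- The slope `|Df|(x) = limsup_{y → x, y ≠ x} |f y - f x| / d(y, x)` of a real function.
At an isolated point the punctured neighbourhood filter is `⊥`, and the `limsup` in `ℝ≥0∞`
along `⊥` is `0`, as it should be. -/
def slope (f : X → ℝ) (x : X) : ℝ≥0∞ :=
  limsup (fun y => edist (f y) (f x) / edist y x) (𝓝[≠] x)

variable [MeasurableSpace X]

/-- Every compact set has a closed `r`-neighbourhood, `r > 0`, of finite measure. -/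
def FiniteNearCompacts (μ : Measure X) : Prop :=
  ∀ K : Set X, IsCompact K → ∃ r : ℝ, 0 < r ∧ μ (Metric.cthickening r K) < ∞

variable {μ : Measure X}

/-- `f` is equal `μ`-a.e. to a real constant. -/
def IsAEConst (f : Lp ℝ 2 μ) : Prop :=
  ∃ c : ℝ, ∀ᵐ x ∂μ, f x = c

/-- `G` is a relaxed gradient of `f`: there are Lipschitz functions `u n` in `L²` with slopes in
`L²` such that `u n → f` strongly in `L²` and `|D (u n)| ⇀ G'` weakly in `L²`, with `G' ≤ G`
a.e. -/
def IsRelaxedGradient (f G : Lp ℝ 2 μ) : Prop :=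
  ∃ (u : ℕ → X → ℝ) (hu : ∀ n, MemLp (u n) 2 μ)
    (hs : ∀ n, MemLp (fun x => (slope (u n) x).toReal) 2 μ) (G' : Lp ℝ 2 μ),
    (∀ n, ∃ K : ℝ≥0, LipschitzWith K (u n)) ∧
    Tendsto (fun n => (hu n).toLp (u n)) atTop (𝓝 f) ∧
    (∀ h : Lp ℝ 2 μ,
      Tendsto (fun n => inner ℝ h ((hs n).toLp (fun x => (slope (u n) x).toReal))) atTop
        (𝓝 (inner ℝ h G'))) ∧
    ∀ᵐ x ∂μ, G' x ≤ G x

/-- `G` is the minimal relaxed gradient `|Df|_*` of `f`: the relaxed gradient of least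
`L²`-norm. -/
def IsMinimalRelaxedGradient (f G : Lp ℝ 2 μ) : Prop :=
  IsRelaxedGradient f G ∧ ∀ G' : Lp ℝ 2 μ, IsRelaxedGradient f G' → ‖G‖ ≤ ‖G'‖

open Classical in
/-- The Cheeger energy `Ch(f) = ½ ∫ |Df|_*² dμ`, with value `∞` if `f` has no relaxed gradient. -/
def cheegerEnergy (f : Lp ℝ 2 μ) : ℝ≥0∞ :=
  if h : ∃ G : Lp ℝ 2 μ, IsMinimalRelaxedGradient f G then
    2⁻¹ * ∫⁻ x, ‖h.choose x‖ₑ ^ 2 ∂μ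
  else ∞

/-- The subdifferential `∂⁻Ch(f)`: all `ℓ ∈ L²` with `∫ ℓ (g - f) dμ + Ch(f) ≤ Ch(g)` for every
`g ∈ L²`. -/
def cheegerSubdifferential (f : Lp ℝ 2 μ) : Set (Lp ℝ 2 μ) :=
  {ℓ | ∀ g : Lp ℝ 2 μ,
    ((∫ x, ℓ x * (g x - f x) ∂μ : ℝ) : EReal) + (cheegerEnergy f : EReal)
      ≤ (cheegerEnergy g : EReal)}

/-- `f ∈ D(Δ)` and `Δ f = ℓ`: the element of minimal `L²`-norm of `∂⁻Ch(f)` is `ℓ`. -/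
def HasLaplacian (f ℓ : Lp ℝ 2 μ) : Prop :=
  ℓ ∈ cheegerSubdifferential f ∧ ∀ ℓ' ∈ cheegerSubdifferential f, ‖ℓ‖ ≤ ‖ℓ'‖

variable (μ) in
/-- The `L²`-Liouville property: every `f ∈ D(Δ)` with `Δ f = 0` is a.e. constant. -/
def L2Liouville : Prop :=
  ∀ f : Lp ℝ 2 μ, HasLaplacian f 0 → IsAEConst f

/-- `u` is, on `(0, ∞)`, a gradient flow of the Cheeger energy starting from `f`: it is locally
Lipschitz on `(0, ∞)`, for a.e. `t > 0` it is differentiable at `t` with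
`u'(t) ∈ -∂⁻Ch(u(t))`, and `u(t) → f` as `t → 0⁺`. -/
def IsHeatFlow (f : Lp ℝ 2 μ) (u : ℝ → Lp ℝ 2 μ) : Prop :=
  LocallyLipschitzOn (Ioi 0) u ∧
  (∀ᵐ t ∂(volume : Measure ℝ), 0 < t →
    ∃ v : Lp ℝ 2 μ, HasDerivAt u v t ∧ -v ∈ cheegerSubdifferential (u t)) ∧
  Tendsto u (𝓝[>] 0) (𝓝 f)

open Classical in
/-- The heat flow `H_t f`, `t > 0`: the value at time `t` of the gradient flow of the Cheeger
energy starting from `f`, unique on `(0, ∞)` (the default value `0` is used only if there is no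
such flow). -/
def heatFlow (t : ℝ) (f : Lp ℝ 2 μ) : Lp ℝ 2 μ :=
  if h : ∃ u : ℝ → Lp ℝ 2 μ, IsHeatFlow f u then h.choose t else 0

end MetricMeasure

end

/-! The Cheeger energy is an even, convex, lower semicontinuous functional on the Hilbert space `Lp
ℝ 2 μ` with dense domain and minimum value `Ch(0) = 0`. Once this is known, everything else is
convex analysis, and all six conditions say that zeros of `Ch` are constant. Indeed `0` is a
subgradient at `f` exactly when `f` minimises `Ch`, that is `Ch(f) = 0`; the constant curve `f` is
then the heat flow, and conversely a single equality `H_t f = f` with `t > 0` forces `Ch(f) = 0`.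
Because `Ch` is even, every trajectory converges strongly as `t → ∞`, and its limit is a zero of
`Ch`. The flow is the limit of implicit Euler schemes with dyadic steps. They converge because one
step `τ` differs from two steps `τ / 2` by a squared error of order `τ²`
(`norm_resolvent_sub_resolvent_half_sq_le`). The limit satisfies an evolution variational inequality
(EVI, `flow_evi`), which yields the differential inclusion, the behaviour at `0` and the behaviour
at infinity. Uniqueness is monotonicity of the subdifferential. Convexity and semicontinuity of `Ch`
hold because the relaxed gradients form the norm closure of a convex set of pairs
(`IsRelaxedGradient.mem_closure` and its converse), so Mazur's lemma applies. Density of the domain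
comes from Lipschitz cutoffs of compact sets, whose neighbourhoods have finite measure by
assumption. -/

noncomputable section

/-! ### Convex functionals on a Hilbert space and their subgradients. -/

namespace ConvexFlow

variable {H : Type*} [NormedAddCommGroup H] [InnerProductSpace ℝ H]

/-- `ξ` is a subgradient of `φ` at the point `x` of its domain. -/
def IsSubgradient (φ : H → ℝ≥0∞) (x ξ : H) : Prop :=
  φ x ≠ ∞ ∧ ∀ y, φ y ≠ ∞ → inner ℝ ξ (y - x) + (φ x).toReal ≤ (φ y).toReal

/-- A convex lower semicontinuous function with dense domain. -/
structure IsConvexLSC (φ : H → ℝ≥0∞) : Prop where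
  convex : ∀ x y, φ x ≠ ∞ → φ y ≠ ∞ → ∀ a b : ℝ, 0 ≤ a → 0 ≤ b → a + b = 1 →
    φ (a • x + b • y) ≠ ∞ ∧
      (φ (a • x + b • y)).toReal ≤ a * (φ x).toReal + b * (φ y).toReal
  lsc : LowerSemicontinuous φ
  dense : Dense {x | φ x ≠ ∞}

variable {φ : H → ℝ≥0∞}

lemma IsSubgradient.monotone {x y ξ η : H} (hx : IsSubgradient φ x ξ) (hy : IsSubgradient φ y η) :
    0 ≤ inner ℝ (ξ - η) (x - y) := by
  have h1 := hx.2 y hy.1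
  have h2 := hy.2 x hx.1
  have h3 : inner ℝ ξ (y - x) = - inner ℝ ξ (x - y) := by rw [← inner_neg_right, neg_sub]
  rw [inner_sub_left]
  linarith

/-- The epigraph is closed. This form passes finiteness and a real bound to the limit together,
which guards against `toReal ∞ = 0`. -/
lemma IsConvexLSC.toReal_le_of_tendsto (hφ : IsConvexLSC φ) {ι : Type*} {l : Filter ι} [l.NeBot]
    {u : ι → H} {x : H} {c : ι → ℝ} {a : ℝ} (hu : Tendsto u l (𝓝 x)) (hc : Tendsto c l (𝓝 a))
    (h : ∀ᶠ i in l, φ (u i) ≠ ∞ ∧ (φ (u i)).toReal ≤ c i) :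
    φ x ≠ ∞ ∧ (φ x).toReal ≤ a := by
  have hmem : φ x ≤ ENNReal.ofReal a := by
    have hcl := hφ.lsc.isClosed_epigraph
    have ht : Tendsto (fun i => (u i, ENNReal.ofReal (c i))) l (𝓝 (x, ENNReal.ofReal a)) :=
      hu.prodMk_nhds (ENNReal.tendsto_ofReal hc)
    exact hcl.mem_of_tendsto ht (h.mono fun i hi => by
      change φ (u i) ≤ _
      rw [← ENNReal.ofReal_toReal hi.1]
      exact ENNReal.ofReal_le_ofReal hi.2)
  have ha : 0 ≤ a := ge_of_tendsto hc (h.mono fun i hi => ENNReal.toReal_nonneg.trans hi.2)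
  exact ⟨ne_top_of_le_ne_top ENNReal.ofReal_ne_top hmem, ENNReal.toReal_le_of_le_ofReal ha hmem⟩

/-! ### The implicit Euler step. -/

lemma norm_sq_midpoint (x y z : H) :
    ‖((1 / 2 : ℝ) • y + (1 / 2 : ℝ) • z) - x‖ ^ 2
      = ‖y - x‖ ^ 2 / 2 + ‖z - x‖ ^ 2 / 2 - ‖y - z‖ ^ 2 / 4 := by
  have h1 : ((1 / 2 : ℝ) • y + (1 / 2 : ℝ) • z) - x
      = (1 / 2 : ℝ) • ((y - x) + (z - x)) := by module
  have h2 : y - z = (y - x) - (z - x) := by abel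
  rw [h1, h2, norm_smul, mul_pow, norm_add_sq_real, norm_sub_sq_real (y - x)]
  norm_num
  ring

/-- No weak compactness is needed: the midpoint identity makes the penalised functional uniformly
convex, so near-minimisers are close to each other and a minimising sequence is Cauchy. -/
lemma exists_minimizer [CompleteSpace H] (hφ : IsConvexLSC φ) {τ : ℝ} (hτ : 0 < τ) (x : H) :
    ∃ y, φ y ≠ ∞ ∧ ∀ z, φ z ≠ ∞ →
      (φ y).toReal + ‖y - x‖ ^ 2 / (2 * τ) ≤ (φ z).toReal + ‖z - x‖ ^ 2 / (2 * τ) := by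
  set F : H → ℝ := fun y => (φ y).toReal + ‖y - x‖ ^ 2 / (2 * τ) with hF
  set D : Set H := {y | φ y ≠ ∞} with hD
  obtain ⟨y₀, hy₀⟩ : D.Nonempty := by
    have : Nonempty H := ⟨0⟩
    exact hφ.dense.nonempty
  have hbdd : BddBelow (F '' D) := by
    refine ⟨0, ?_⟩
    rintro _ ⟨y, -, rfl⟩
    positivity
  set m := sInf (F '' D) with hm
  have hle : ∀ z ∈ D, m ≤ F z := fun z hz => csInf_le hbdd ⟨z, hz, rfl⟩
  have hex : ∀ n : ℕ, ∃ y ∈ D, F y < m + 1 / ((n : ℝ) + 1) := by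
    intro n
    have hlt : m < m + 1 / ((n : ℝ) + 1) := by
      have : (0 : ℝ) < 1 / ((n : ℝ) + 1) := by positivity
      linarith
    obtain ⟨_, ⟨y, hy, rfl⟩, h⟩ := exists_lt_of_csInf_lt (s := F '' D) ⟨F y₀, y₀, hy₀, rfl⟩ hlt
    exact ⟨y, hy, h⟩
  choose y hyD hyF using hex
  have hmid : ∀ a ∈ D, ∀ b ∈ D, ‖a - b‖ ^ 2 ≤ 8 * τ * ((F a + F b) / 2 - m) := by
    intro a ha b hb
    obtain ⟨h1, h2⟩ := hφ.convex a b ha hb (1 / 2) (1 / 2) (by norm_num) (by norm_num) (by norm_num)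
    have h3 := hle _ h1
    simp only [hF] at h3
    rw [norm_sq_midpoint x a b] at h3
    have h4 : ‖a - b‖ ^ 2 / (8 * τ) ≤ (F a + F b) / 2 - m := by
      simp only [hF]
      have : (‖a - x‖ ^ 2 / 2 + ‖b - x‖ ^ 2 / 2 - ‖a - b‖ ^ 2 / 4) / (2 * τ)
        = ‖a - x‖ ^ 2 / (2 * τ) / 2 + ‖b - x‖ ^ 2 / (2 * τ) / 2 - ‖a - b‖ ^ 2 / (8 * τ) := by
        field_simp
        ring
      linarith
    rwa [div_le_iff₀ (by positivity), mul_comm] at h4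
  have hone : Tendsto (fun n : ℕ => 1 / ((n : ℝ) + 1)) atTop (𝓝 0) :=
    tendsto_one_div_add_atTop_nhds_zero_nat
  have hC : CauchySeq y := by
    refine cauchySeq_of_le_tendsto_0 (fun n : ℕ => √(8 * τ * (1 / ((n : ℝ) + 1)))) ?_ ?_
    · intro n k N hn hk
      rw [dist_eq_norm]
      refine Real.le_sqrt_of_sq_le ((hmid _ (hyD n) _ (hyD k)).trans ?_)
      have h1 : 1 / ((n : ℝ) + 1) ≤ 1 / ((N : ℝ) + 1) := by gcongr
      have h2 : 1 / ((k : ℝ) + 1) ≤ 1 / ((N : ℝ) + 1) := by gcongr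
      have := hyF n
      have := hyF k
      gcongr
      linarith
    · have := (hone.const_mul (8 * τ)).sqrt
      simpa using this
  obtain ⟨z, hz⟩ := cauchySeq_tendsto_of_complete hC
  have hlim : Tendsto (fun n : ℕ => m + 1 / ((n : ℝ) + 1) - ‖y n - x‖ ^ 2 / (2 * τ)) atTop
      (𝓝 (m + 0 - ‖z - x‖ ^ 2 / (2 * τ))) :=
    (hone.const_add m).sub ((((hz.sub_const x).norm).pow 2).div_const _)
  obtain ⟨h1, h2⟩ := hφ.toReal_le_of_tendsto hz hlim (Eventually.of_forall fun n => ⟨hyD n, by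
    have := (hyF n).le
    simp only [hF] at this
    linarith⟩)
  exact ⟨z, h1, fun w hw => by have := hle w hw; simp only [hF] at this; linarith⟩

/-- The Euler–Lagrange condition: compare the minimiser `y` with `(1 - θ) • y + θ • g`, divide by
`θ` and let `θ → 0⁺`. -/
lemma exists_resolvent [CompleteSpace H] (hφ : IsConvexLSC φ) {τ : ℝ} (hτ : 0 < τ) (x : H) :
    ∃ y, IsSubgradient φ y (τ⁻¹ • (x - y)) := by
  obtain ⟨y, hy, hmin⟩ := exists_minimizer hφ hτ x
  refine ⟨y, hy, fun g hg => ?_⟩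
  have key : ∀ θ : ℝ, 0 < θ → θ ≤ 1 →
      τ⁻¹ * inner ℝ (x - y) (g - y) + (φ y).toReal
        ≤ (φ g).toReal + θ * (‖g - y‖ ^ 2 / (2 * τ)) := by
    intro θ h0 h1
    obtain ⟨h2, h3⟩ := hφ.convex y g hy hg (1 - θ) θ (by linarith) h0.le (by ring)
    have h4 := hmin _ h2
    have h5 : (1 - θ) • y + θ • g - x = θ • (g - y) - (x - y) := by module
    rw [h5, norm_sub_sq_real (θ • _), norm_smul, inner_smul_left, Real.norm_of_nonneg h0.le,
      norm_sub_rev y x, real_inner_comm] at h4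
    simp only [conj_trivial] at h4
    have h6 : θ * (τ⁻¹ * inner ℝ (x - y) (g - y) + (φ y).toReal)
        ≤ θ * ((φ g).toReal + θ * (‖g - y‖ ^ 2 / (2 * τ))) := by
      have : ((θ * ‖g - y‖) ^ 2 - 2 * (θ * inner ℝ (x - y) (g - y)) + ‖x - y‖ ^ 2) / (2 * τ)
          = θ * (θ * (‖g - y‖ ^ 2 / (2 * τ))) - θ * (τ⁻¹ * inner ℝ (x - y) (g - y))
            + ‖x - y‖ ^ 2 / (2 * τ) := by
        field_simp
      linarith
    exact le_of_mul_le_mul_left h6 h0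
  rw [inner_smul_left]
  simp only [conj_trivial]
  have hlim : Tendsto (fun θ : ℝ => (φ g).toReal + θ * (‖g - y‖ ^ 2 / (2 * τ))) (𝓝[>] 0)
      (𝓝 ((φ g).toReal + 0 * (‖g - y‖ ^ 2 / (2 * τ)))) := by
    have : Continuous (fun θ : ℝ => (φ g).toReal + θ * (‖g - y‖ ^ 2 / (2 * τ))) := by fun_prop
    exact (this.tendsto 0).mono_left nhdsWithin_le_nhds
  rw [zero_mul, add_zero] at hlim
  refine ge_of_tendsto hlim ?_
  filter_upwards [Ioc_mem_nhdsGT (zero_lt_one' ℝ)] with θ hθ using key θ hθ.1 hθ.2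

open Classical in
/-- The resolvent `(1 + τ ∂φ)⁻¹`, one step of the implicit Euler scheme. -/
def resolvent (φ : H → ℝ≥0∞) (τ : ℝ) (x : H) : H :=
  if h : ∃ y, IsSubgradient φ y (τ⁻¹ • (x - y)) then h.choose else x

section Resolvent

variable [CompleteSpace H] (hφ : IsConvexLSC φ) {τ : ℝ} (hτ : 0 < τ)
include hφ hτ

lemma resolvent_spec (x : H) :
    IsSubgradient φ (resolvent φ τ x) (τ⁻¹ • (x - resolvent φ τ x)) := by
  have h := exists_resolvent hφ hτ x
  rw [resolvent, dif_pos h]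
  exact h.choose_spec

lemma norm_resolvent_sub_le (x y : H) :
    ‖resolvent φ τ x - resolvent φ τ y‖ ≤ ‖x - y‖ := by
  set p := resolvent φ τ x with hp
  set q := resolvent φ τ y with hq
  have h := (resolvent_spec hφ hτ x).monotone (resolvent_spec hφ hτ y)
  rw [← hp, ← hq, ← smul_sub, inner_smul_left] at h
  simp only [conj_trivial] at h
  have h1 : 0 ≤ inner ℝ (x - p - (y - q)) (p - q) := by
    by_contra hneg
    exact absurd h (not_le.2 (mul_neg_of_pos_of_neg (inv_pos.2 hτ) (not_le.1 hneg)))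
  have h2 : x - p - (y - q) = (x - y) - (p - q) := by abel
  rw [h2, inner_sub_left, real_inner_self_eq_norm_sq] at h1
  have h3 := real_inner_le_norm (x - y) (p - q)
  by_contra hlt
  push Not at hlt
  nlinarith [norm_nonneg (x - y), norm_nonneg (p - q)]

lemma resolvent_ne_top (x : H) : φ (resolvent φ τ x) ≠ ∞ := (resolvent_spec hφ hτ x).1

/-- Discrete EVI: the subgradient inequality at the new point, multiplied by `τ`, with the inner
product rewritten through squared norms. -/
lemma resolvent_evi (x : H) {z : H} (hz : φ z ≠ ∞) :
    ‖resolvent φ τ x - z‖ ^ 2 / 2 + τ * (φ (resolvent φ τ x)).toReal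
      + ‖x - resolvent φ τ x‖ ^ 2 / 2 ≤ ‖x - z‖ ^ 2 / 2 + τ * (φ z).toReal := by
  set p := resolvent φ τ x with hp
  have h := (resolvent_spec hφ hτ x).2 z hz
  rw [← hp, inner_smul_left] at h
  simp only [conj_trivial] at h
  have h1 : x - z = (x - p) - (z - p) := by abel
  have h3 : inner ℝ (x - p) (z - p) + τ * (φ p).toReal ≤ τ * (φ z).toReal := by
    have := mul_le_mul_of_nonneg_left h hτ.le
    rw [mul_add, ← mul_assoc, mul_inv_cancel₀ hτ.ne', one_mul] at this
    exact this
  rw [h1, norm_sub_sq_real (x - p), norm_sub_rev p z]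
  linarith

lemma toReal_resolvent_le {x : H} (hx : φ x ≠ ∞) :
    (φ (resolvent φ τ x)).toReal ≤ (φ x).toReal := by
  have h := resolvent_evi hφ hτ x hx
  rw [sub_self, norm_zero] at h
  have : τ * (φ (resolvent φ τ x)).toReal ≤ τ * (φ x).toReal := by
    nlinarith [sq_nonneg ‖resolvent φ τ x - x‖, sq_nonneg ‖x - resolvent φ τ x‖]
  exact le_of_mul_le_mul_left this hτ

lemma norm_sub_resolvent_le {x ξ : H} (hx : IsSubgradient φ x ξ) :
    ‖x - resolvent φ τ x‖ ≤ τ * ‖ξ‖ := by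
  set p := resolvent φ τ x with hp
  have h := hx.monotone (resolvent_spec hφ hτ x)
  rw [← hp, inner_sub_left, inner_smul_left, real_inner_self_eq_norm_sq] at h
  simp only [conj_trivial] at h
  have h2 := real_inner_le_norm ξ (x - p)
  have h3 : τ⁻¹ * ‖x - p‖ ^ 2 ≤ ‖ξ‖ * ‖x - p‖ := by linarith
  rw [inv_mul_le_iff₀ hτ] at h3
  by_contra hlt
  push Not at hlt
  nlinarith [norm_nonneg (x - p), norm_nonneg ξ, mul_nonneg hτ.le (norm_nonneg ξ)]

lemma norm_iterate_sub_le (k : ℕ) (x y : H) :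
    ‖(resolvent φ τ)^[k] x - (resolvent φ τ)^[k] y‖ ≤ ‖x - y‖ := by
  induction k with
  | zero => simp
  | succ k ih =>
    rw [Function.iterate_succ_apply', Function.iterate_succ_apply']
    exact (norm_resolvent_sub_le hφ hτ _ _).trans ih

/-- Each pair of consecutive iterates is the image of the previous pair under a nonexpansive map. -/
lemma norm_iterate_succ_sub_antitone (x : H) :
    Antitone fun k => ‖(resolvent φ τ)^[k] x - (resolvent φ τ)^[k + 1] x‖ := by
  refine antitone_nat_of_succ_le fun k => ?_
  have h := norm_resolvent_sub_le hφ hτ ((resolvent φ τ)^[k] x) ((resolvent φ τ)^[k + 1] x)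
  rwa [← Function.iterate_succ_apply' (resolvent φ τ),
    ← Function.iterate_succ_apply' (resolvent φ τ)] at h

lemma norm_iterate_sub_succ_le {x ξ : H} (hx : IsSubgradient φ x ξ) (k : ℕ) :
    ‖(resolvent φ τ)^[k] x - (resolvent φ τ)^[k + 1] x‖ ≤ τ * ‖ξ‖ :=
  (norm_iterate_succ_sub_antitone hφ hτ x (Nat.zero_le k)).trans
    (norm_sub_resolvent_le hφ hτ hx)

lemma iterate_ne_top (x : H) {k : ℕ} (hk : k ≠ 0) : φ ((resolvent φ τ)^[k] x) ≠ ∞ := by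
  obtain ⟨k, rfl⟩ := Nat.exists_eq_succ_of_ne_zero hk
  rw [Function.iterate_succ_apply']
  exact resolvent_ne_top hφ hτ _

/-- Sum the one-step inequalities; the energy decreases along the scheme, so the last value bounds
all earlier ones from below. -/
lemma iterate_evi (x : H) {z : H} (hz : φ z ≠ ∞) (m : ℕ) :
    ‖(resolvent φ τ)^[m] x - z‖ ^ 2 / 2 + m * τ * (φ ((resolvent φ τ)^[m] x)).toReal
      ≤ ‖x - z‖ ^ 2 / 2 + m * τ * (φ z).toReal := by
  induction m with
  | zero => simp
  | succ m ih =>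
    rw [Function.iterate_succ_apply']
    set y := (resolvent φ τ)^[m] x with hy
    have h1 := resolvent_evi hφ hτ y hz
    have h2 : m * τ * (φ (resolvent φ τ y)).toReal ≤ m * τ * (φ y).toReal := by
      rcases Nat.eq_zero_or_pos m with rfl | hm
      · simp
      · have := toReal_resolvent_le hφ hτ (iterate_ne_top hφ hτ x hm.ne')
        rw [← hy] at this
        gcongr
    push_cast
    nlinarith [sq_nonneg ‖y - resolvent φ τ y‖]

/-- The squared step lengths are paid for by the energy drop, and the lengths decrease, so the
latest one is at most the average. -/
lemma iterate_speed_le {y : H} (hy : φ y ≠ ∞) (m : ℕ) :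
    m * ‖(resolvent φ τ)^[m] y - (resolvent φ τ)^[m + 1] y‖ ^ 2
      ≤ 2 * τ * ((φ y).toReal - (φ ((resolvent φ τ)^[m] y)).toReal) := by
  induction m with
  | zero => simp
  | succ m ih =>
    have hanti := norm_iterate_succ_sub_antitone hφ hτ y (Nat.le_succ m)
    simp only at hanti
    have hfin : φ ((resolvent φ τ)^[m] y) ≠ ∞ := by
      rcases Nat.eq_zero_or_pos m with rfl | hm
      · simpa using hy
      · exact iterate_ne_top hφ hτ y hm.ne'
    have h1 := resolvent_evi hφ hτ ((resolvent φ τ)^[m] y) hfin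
    rw [← Function.iterate_succ_apply' (resolvent φ τ), sub_self, norm_zero, norm_sub_rev] at h1
    have h2 := pow_le_pow_left₀ (norm_nonneg _) hanti 2
    have h3 : (m : ℝ) * ‖(resolvent φ τ)^[m + 1] y - (resolvent φ τ)^[m + 1 + 1] y‖ ^ 2
      ≤ m * ‖(resolvent φ τ)^[m] y - (resolvent φ τ)^[m + 1] y‖ ^ 2 := by gcongr
    push_cast
    nlinarith [sq_nonneg ‖(resolvent φ τ)^[m] y - (resolvent φ τ)^[m + 1] y‖]

end Resolvent

/-! ### Comparison of step `τ` with step `τ / 2`. -/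

section Resolvent

variable [CompleteSpace H] (hφ : IsConvexLSC φ)
include hφ

/-- With `z` the full step and `p`, `q` the two half steps, `x - y` is `z - q` plus the average of
two differences of rescaled subgradients. Monotonicity makes the second cross term nonnegative. The
first difference is monotone against `z - p` rather than `z - q`, and this mismatch costs at most
`2τM · τM/2 = (τM)²`. -/
lemma norm_resolvent_sub_resolvent_half_sq_le {τ : ℝ} (hτ : 0 < τ) {M : ℝ} {x y : H}
    (hx : ‖x - resolvent φ τ x‖ ≤ τ * M)
    (hy : ‖y - resolvent φ (τ / 2) y‖ ≤ τ / 2 * M)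
    (hy' : ‖resolvent φ (τ / 2) y - resolvent φ (τ / 2) (resolvent φ (τ / 2) y)‖ ≤ τ / 2 * M) :
    ‖resolvent φ τ x - resolvent φ (τ / 2) (resolvent φ (τ / 2) y)‖ ^ 2
      ≤ ‖x - y‖ ^ 2 + (τ * M) ^ 2 := by
  have hτ2 : 0 < τ / 2 := by positivity
  set z := resolvent φ τ x with hz
  set p := resolvent φ (τ / 2) y with hp
  set q := resolvent φ (τ / 2) p with hq
  have hmono : ∀ {u v : H}, IsSubgradient φ v ((τ / 2)⁻¹ • (u - v)) →
      0 ≤ inner ℝ (x - z - (2 : ℝ) • (u - v)) (z - v) := by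
    intro u v huv
    have h := (resolvent_spec hφ hτ x).monotone huv
    rw [← hz] at h
    have he : τ⁻¹ • (x - z) - (τ / 2)⁻¹ • (u - v) = τ⁻¹ • (x - z - (2 : ℝ) • (u - v)) := by
      rw [show (τ / 2)⁻¹ = τ⁻¹ * 2 by field_simp]
      module
    rw [he, inner_smul_left] at h
    simp only [conj_trivial] at h
    exact nonneg_of_mul_nonneg_right h (inv_pos.2 hτ)
  have h1 := hmono (resolvent_spec hφ hτ2 y)
  have h2 := hmono (resolvent_spec hφ hτ2 p)
  rw [← hp] at h1
  rw [← hq] at h2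
  have e1 : x - y = (z - q) + ((1 / 2 : ℝ) • ((x - z - (2 : ℝ) • (y - p))
      + (x - z - (2 : ℝ) • (p - q)))) := by module
  have e2 : z - q = (z - p) + (p - q) := by abel
  have h3 : inner ℝ (x - z - (2 : ℝ) • (y - p)) (z - q)
      = inner ℝ (x - z - (2 : ℝ) • (y - p)) (z - p)
        + inner ℝ (x - z - (2 : ℝ) • (y - p)) (p - q) := by rw [e2, inner_add_right]
  have h4 : -(τ * M) ^ 2 ≤ inner ℝ (x - z - (2 : ℝ) • (y - p)) (p - q) := by
    have hn : ‖x - z - (2 : ℝ) • (y - p)‖ ≤ 2 * (τ * M) := by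
      refine (norm_sub_le _ _).trans ?_
      rw [norm_smul]
      norm_num
      linarith
    have hb := abs_le.1 (abs_real_inner_le_norm (x - z - (2 : ℝ) • (y - p)) (p - q))
    have hm := mul_le_mul hn hy' (norm_nonneg _) ((norm_nonneg _).trans hn)
    nlinarith [hb.1]
  have h5 : ‖x - y‖ ^ 2 = ‖z - q‖ ^ 2 + (inner ℝ (x - z - (2 : ℝ) • (y - p)) (z - q)
      + inner ℝ (x - z - (2 : ℝ) • (p - q)) (z - q))
      + ‖(1 / 2 : ℝ) • ((x - z - (2 : ℝ) • (y - p)) + (x - z - (2 : ℝ) • (p - q)))‖ ^ 2 := by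
    conv_lhs => rw [e1, norm_add_sq_real, inner_smul_right, inner_add_right, real_inner_comm,
      real_inner_comm (x - z - (2 : ℝ) • (p - q))]
    ring
  have h6 := sq_nonneg
    ‖(1 / 2 : ℝ) • ((x - z - (2 : ℝ) • (y - p)) + (x - z - (2 : ℝ) • (p - q)))‖
  linarith

lemma norm_iterate_sub_iterate_half_sq_le {τ : ℝ} (hτ : 0 < τ) {x ξ : H}
    (hx : IsSubgradient φ x ξ) (k : ℕ) :
    ‖(resolvent φ τ)^[k] x - (resolvent φ (τ / 2))^[2 * k] x‖ ^ 2 ≤ k * (τ * ‖ξ‖) ^ 2 := by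
  have hτ2 : 0 < τ / 2 := by positivity
  induction k with
  | zero => simp
  | succ k ih =>
    have h1 := norm_iterate_sub_succ_le hφ hτ hx k
    have h2 := norm_iterate_sub_succ_le hφ hτ2 hx (2 * k)
    have h3 := norm_iterate_sub_succ_le hφ hτ2 hx (2 * k + 1)
    simp only [Function.iterate_succ_apply'] at h1 h2 h3
    rw [mul_add, mul_one, Function.iterate_succ_apply', Function.iterate_succ_apply',
      Function.iterate_succ_apply']
    have := norm_resolvent_sub_resolvent_half_sq_le hφ hτ h1 h2 h3
    push_cast
    linarith

lemma norm_iterate_add_sub_le {τ : ℝ} (hτ : 0 < τ) {x : H} {j : ℕ} {D : ℝ}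
    (hD : ‖(resolvent φ τ)^[j] x - (resolvent φ τ)^[j + 1] x‖ ≤ D) {k : ℕ} (hk : j ≤ k) (l : ℕ) :
    ‖(resolvent φ τ)^[k + l] x - (resolvent φ τ)^[k] x‖ ≤ l * D := by
  induction l with
  | zero => simp
  | succ l ih =>
    have h1 := norm_iterate_succ_sub_antitone hφ hτ x (hk.trans (Nat.le_add_right k l))
    simp only at h1
    rw [norm_sub_rev] at h1
    have h2 := norm_sub_le_norm_sub_add_norm_sub ((resolvent φ τ)^[k + l + 1] x)
      ((resolvent φ τ)^[k + l] x) ((resolvent φ τ)^[k] x)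
    push_cast
    rw [← add_assoc]
    linarith

/-- Resolvents of a point of the domain carry subgradients and tend to that point as `τ → 0`. -/
lemma dense_subgradient : Dense {x | ∃ ξ, IsSubgradient φ x ξ} := by
  refine dense_iff_closure_eq.2 (eq_univ_of_univ_subset ?_)
  rw [← hφ.dense.closure_eq]
  refine closure_minimal (fun z hz => ?_) isClosed_closure
  have hlim : Tendsto (fun n : ℕ => resolvent φ (1 / ((n : ℝ) + 1)) z) atTop (𝓝 z) := by
    rw [tendsto_iff_norm_sub_tendsto_zero]
    have h0 : Tendsto (fun n : ℕ => √(2 * (1 / ((n : ℝ) + 1) * (φ z).toReal))) atTop (𝓝 0) := by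
      have := ((tendsto_one_div_add_atTop_nhds_zero_nat (𝕜 := ℝ)).mul_const
        (φ z).toReal).const_mul 2 |>.sqrt
      simpa using this
    refine squeeze_zero (fun _ => norm_nonneg _) (fun n => ?_) h0
    have hpos : (0 : ℝ) < 1 / ((n : ℝ) + 1) := by positivity
    refine Real.le_sqrt_of_sq_le ?_
    have h := resolvent_evi hφ hpos z hz
    have h1 : 0 ≤ 1 / ((n : ℝ) + 1) * (φ (resolvent φ (1 / ((n : ℝ) + 1)) z)).toReal := by
      positivity
    rw [sub_self, norm_zero, norm_sub_rev z] at h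
    nlinarith [sq_nonneg ‖resolvent φ (1 / ((n : ℝ) + 1)) z - z‖]
  refine mem_closure_of_tendsto hlim (Eventually.of_forall fun n => ⟨_, resolvent_spec hφ ?_ z⟩)
  positivity

end Resolvent

/-! ### The flow as a limit of Euler schemes. -/

/-- Implicit Euler scheme with time step `2⁻ⁿ`, at time `t`. -/
def eulerScheme (φ : H → ℝ≥0∞) (n : ℕ) (t : ℝ) (x : H) : H :=
  (resolvent φ ((2 : ℝ) ^ n)⁻¹)^[⌊t * 2 ^ n⌋₊] x

/-- The limit of the implicit Euler schemes. -/
def flow (φ : H → ℝ≥0∞) (t : ℝ) (x : H) : H :=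
  limUnder atTop fun n => eulerScheme φ n t x

lemma floor_two_mul {r : ℝ} (hr : 0 ≤ r) : ⌊r * 2⌋₊ = 2 * ⌊r⌋₊ ∨ ⌊r * 2⌋₊ = 2 * ⌊r⌋₊ + 1 := by
  have h1 : 2 * ⌊r⌋₊ ≤ ⌊r * 2⌋₊ := by
    apply Nat.le_floor
    push_cast
    linarith [Nat.floor_le hr]
  have h2 : ⌊r * 2⌋₊ < 2 * ⌊r⌋₊ + 2 := by
    rw [Nat.floor_lt (by positivity)]
    push_cast
    linarith [Nat.lt_floor_add_one r]
  omega

lemma tendsto_floor_mul_two_pow {t : ℝ} (ht : 0 ≤ t) :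
    Tendsto (fun n : ℕ => (⌊t * 2 ^ n⌋₊ : ℝ) * ((2 : ℝ) ^ n)⁻¹) atTop (𝓝 t) := by
  have h := (tendsto_nat_floor_mul_div_atTop ht).comp
    (tendsto_pow_atTop_atTop_of_one_lt (one_lt_two (α := ℝ)))
  exact h.congr fun n => by simp [div_eq_mul_inv]

section Flow

variable [CompleteSpace H] (hφ : IsConvexLSC φ)
include hφ

lemma norm_eulerScheme_sub_le (n : ℕ) (t : ℝ) (x y : H) :
    ‖eulerScheme φ n t x - eulerScheme φ n t y‖ ≤ ‖x - y‖ :=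
  norm_iterate_sub_le hφ (by positivity) _ x y

/-- About `t / τ` steps, each adding `(τ‖ξ‖)²` to the squared error, give `√t √τ ‖ξ‖`. The extra `1`
covers a possible odd half step left by rounding, and `√τ = (√(1/2))ⁿ` is summable. -/
lemma dist_eulerScheme_succ_le {x ξ : H} (hx : IsSubgradient φ x ξ) {t : ℝ} (ht : 0 ≤ t) (n : ℕ) :
    dist (eulerScheme φ n t x) (eulerScheme φ (n + 1) t x)
      ≤ (√t + 1) * ‖ξ‖ * (√(1 / 2)) ^ n := by
  have hτ : (0 : ℝ) < ((2 : ℝ) ^ n)⁻¹ := by positivity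
  have hr : (√(1 / 2 : ℝ)) ^ n = √(((2 : ℝ) ^ n)⁻¹) := by
    rw [← inv_pow, ← one_div]
    refine ((Real.sqrt_eq_iff_mul_self_eq (by positivity) (by positivity)).2 ?_).symm
    rw [← mul_pow, Real.mul_self_sqrt (by norm_num)]
  have hτ1 : ((2 : ℝ) ^ n)⁻¹ ≤ 1 := inv_le_one_of_one_le₀ (one_le_pow₀ (by norm_num))
  rw [hr]
  unfold eulerScheme
  have hhalf : ((2 : ℝ) ^ (n + 1))⁻¹ = ((2 : ℝ) ^ n)⁻¹ / 2 := by
    rw [pow_succ, mul_inv]; ring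
  have hfl : t * 2 ^ (n + 1) = t * 2 ^ n * 2 := by ring
  rw [hhalf, hfl]
  have hkt : (⌊t * 2 ^ n⌋₊ : ℝ) * ((2 : ℝ) ^ n)⁻¹ ≤ t := by
    rw [← div_eq_mul_inv, div_le_iff₀ (by positivity)]
    exact Nat.floor_le (by positivity)
  set τ := ((2 : ℝ) ^ n)⁻¹ with hτdef
  set k := ⌊t * 2 ^ n⌋₊ with hk
  have h1 : ‖(resolvent φ τ)^[k] x - (resolvent φ (τ / 2))^[2 * k] x‖ ≤ √t * √τ * ‖ξ‖ := by
    refine abs_le_of_sq_le_sq' ?_ (by positivity) |>.2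
    refine (norm_iterate_sub_iterate_half_sq_le hφ hτ hx k).trans ?_
    have e1 : (√t * √τ * ‖ξ‖) ^ 2 = t * τ * ‖ξ‖ ^ 2 := by
      rw [mul_pow, mul_pow, Real.sq_sqrt ht, Real.sq_sqrt hτ.le]
    have e2 : k * (τ * ‖ξ‖) ^ 2 = (k * τ) * τ * ‖ξ‖ ^ 2 := by ring
    rw [e1, e2]
    gcongr
  have hτs : τ ≤ √τ := by
    refine Real.le_sqrt_of_sq_le ?_
    nlinarith
  have h2 : ‖(resolvent φ (τ / 2))^[2 * k] x - (resolvent φ (τ / 2))^[⌊t * 2 ^ n * 2⌋₊] x‖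
      ≤ √τ * ‖ξ‖ := by
    rcases floor_two_mul (r := t * 2 ^ n) (by positivity) with h | h
    · rw [h, sub_self, norm_zero]
      positivity
    · rw [h]
      refine (norm_iterate_sub_succ_le hφ (by positivity) hx _).trans ?_
      gcongr
      linarith
  rw [dist_eq_norm]
  refine (norm_sub_le_norm_sub_add_norm_sub _ ((resolvent φ (τ / 2))^[2 * k] x) _).trans ?_
  nlinarith

/-- The rate is available only at points with a subgradient; density and nonexpansiveness extend
convergence to all starting points. -/
lemma cauchySeq_eulerScheme (x : H) {t : ℝ} (ht : 0 ≤ t) :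
    CauchySeq fun n => eulerScheme φ n t x := by
  rw [Metric.cauchySeq_iff']
  intro ε hε
  obtain ⟨y, ⟨ξ, hξ⟩, hy⟩ := Metric.mem_closure_iff.1 ((dense_subgradient hφ) x) (ε / 3)
    (by positivity)
  have hr : √(1 / 2 : ℝ) < 1 := by
    rw [Real.sqrt_lt' one_pos]
    norm_num
  have hC := cauchySeq_of_le_geometric _ _ hr (dist_eulerScheme_succ_le hφ hξ ht)
  obtain ⟨N, hN⟩ := Metric.cauchySeq_iff'.1 hC (ε / 3) (by positivity)
  refine ⟨N, fun n hn => ?_⟩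
  have h1 := norm_eulerScheme_sub_le hφ n t x y
  have h2 := norm_eulerScheme_sub_le hφ N t y x
  have h3 := hN n hn
  rw [← dist_eq_norm, ← dist_eq_norm] at h1 h2
  rw [dist_comm y x] at h2
  have := dist_triangle4 (eulerScheme φ n t x) (eulerScheme φ n t y) (eulerScheme φ N t y)
    (eulerScheme φ N t x)
  linarith

lemma tendsto_eulerScheme (x : H) {t : ℝ} (ht : 0 ≤ t) :
    Tendsto (fun n => eulerScheme φ n t x) atTop (𝓝 (flow φ t x)) :=
  (cauchySeq_eulerScheme hφ x ht).tendsto_limUnder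

lemma flow_zero (x : H) : flow φ 0 x = x := by
  refine tendsto_nhds_unique (tendsto_eulerScheme hφ x le_rfl) ?_
  simp [eulerScheme]

/-- The evolution variational inequality satisfied by the flow. -/
lemma flow_evi (x : H) {z : H} (hz : φ z ≠ ∞) {s t : ℝ} (hs : 0 ≤ s) (hst : s < t) :
    φ (flow φ t x) ≠ ∞ ∧
      ‖flow φ t x - z‖ ^ 2 / 2 + (t - s) * (φ (flow φ t x)).toReal
        ≤ ‖flow φ s x - z‖ ^ 2 / 2 + (t - s) * (φ z).toReal := by
  have ht : 0 ≤ t := hs.trans hst.le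
  have hts : 0 < t - s := sub_pos.2 hst
  have hδ := (tendsto_floor_mul_two_pow ht).sub (tendsto_floor_mul_two_pow hs)
  -- The discrete EVI solved for the energy at time `t`, so that lower semicontinuity applies to it.
  have hc : Tendsto (fun n : ℕ => (φ z).toReal
      + (‖eulerScheme φ n s x - z‖ ^ 2 / 2 - ‖eulerScheme φ n t x - z‖ ^ 2 / 2)
        / ((⌊t * 2 ^ n⌋₊ : ℝ) * ((2 : ℝ) ^ n)⁻¹ - (⌊s * 2 ^ n⌋₊ : ℝ) * ((2 : ℝ) ^ n)⁻¹)) atTop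
      (𝓝 ((φ z).toReal + (‖flow φ s x - z‖ ^ 2 / 2 - ‖flow φ t x - z‖ ^ 2 / 2) / (t - s))) := by
    refine Tendsto.const_add _ (Tendsto.div ?_ hδ hts.ne')
    exact (((((tendsto_eulerScheme hφ x hs).sub_const z).norm.pow 2).div_const 2).sub
      ((((tendsto_eulerScheme hφ x ht).sub_const z).norm.pow 2).div_const 2))
  obtain ⟨h1, h2⟩ := hφ.toReal_le_of_tendsto (tendsto_eulerScheme hφ x ht) hc (by
    filter_upwards [hδ.eventually (lt_mem_nhds hts)] with n hn
    have hτ : (0 : ℝ) < ((2 : ℝ) ^ n)⁻¹ := by positivity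
    have hlt : ⌊s * 2 ^ n⌋₊ < ⌊t * 2 ^ n⌋₊ := by
      rw [← sub_mul] at hn
      have := pos_of_mul_pos_left hn hτ.le
      exact_mod_cast sub_pos.1 this
    obtain ⟨m, hm⟩ := Nat.exists_eq_add_of_lt hlt
    have he : eulerScheme φ n t x
        = (resolvent φ ((2 : ℝ) ^ n)⁻¹)^[m + 1] (eulerScheme φ n s x) := by
      unfold eulerScheme
      rw [hm, ← Function.iterate_add_apply]
      congr 1
      omega
    have hevi := iterate_evi hφ hτ (eulerScheme φ n s x) hz (m + 1)
    rw [← he] at hevi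
    refine ⟨by rw [he]; exact iterate_ne_top hφ hτ _ (Nat.succ_ne_zero m), ?_⟩
    have hd : (⌊t * 2 ^ n⌋₊ : ℝ) * ((2 : ℝ) ^ n)⁻¹ - (⌊s * 2 ^ n⌋₊ : ℝ) * ((2 : ℝ) ^ n)⁻¹
        = ((m + 1 : ℕ) : ℝ) * ((2 : ℝ) ^ n)⁻¹ := by
      rw [hm]
      push_cast
      ring
    rw [hd, ← sub_le_iff_le_add', le_div_iff₀ (by positivity)]
    linarith)
  refine ⟨h1, ?_⟩
  rw [← sub_le_iff_le_add', le_div_iff₀ hts] at h2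
  linarith

/-- Smoothing effect: by time `a / 2` the energy is at most `E` even if `x` has infinite energy.
Dissipation on `[a / 2, a]` then bounds the step length at time `a` by `τ * D`, and steps only
shrink afterwards. -/
lemma flow_lipschitz (x : H) {a : ℝ} (ha : 0 < a) :
    ∃ K : ℝ≥0, LipschitzOnWith K (fun t => flow φ t x) (Ici a) := by
  have : Nonempty H := ⟨0⟩
  obtain ⟨g, hg⟩ : {x | φ x ≠ ∞}.Nonempty := hφ.dense.nonempty
  set E : ℝ := (φ g).toReal + ‖x - g‖ ^ 2 / (a / 2) with hE
  have hE0 : 0 ≤ E := by positivity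
  set D : ℝ := √(8 * E / a) with hD
  have h2 := tendsto_floor_mul_two_pow ha.le
  have h1 := tendsto_floor_mul_two_pow (half_pos ha).le
  have hbound : ∀ᶠ n : ℕ in atTop, ∀ s t, a ≤ s → s ≤ t →
      ‖eulerScheme φ n t x - eulerScheme φ n s x‖
        ≤ ((⌊t * 2 ^ n⌋₊ : ℝ) * ((2 : ℝ) ^ n)⁻¹ - (⌊s * 2 ^ n⌋₊ : ℝ) * ((2 : ℝ) ^ n)⁻¹) * D := by
    -- Rounding may shorten both half intervals; for large `n` each keeps length above `a / 4`,
    -- which is the source of the constants in `E` and `D`.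
    have hl1 : a / 4 < a / 2 := by linarith
    have hl2 : a / 4 < a - a / 2 := by linarith
    filter_upwards [h1.eventually (lt_mem_nhds hl1), (h2.sub h1).eventually (lt_mem_nhds hl2)]
      with n hn1 hn2 s t has hst
    set τ := ((2 : ℝ) ^ n)⁻¹ with hτdef
    have hτ : 0 < τ := by positivity
    set i := ⌊a / 2 * 2 ^ n⌋₊ with hi
    set j := ⌊a * 2 ^ n⌋₊ with hj
    have hij : i ≤ j := Nat.floor_le_floor (by gcongr; linarith)
    obtain ⟨m, hm⟩ := Nat.exists_eq_add_of_le hij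
    have hi0 : i ≠ 0 := by
      rintro h0
      rw [h0] at hn1
      simp at hn1
      linarith
    have hmτ : a / 4 < m * τ := by
      rw [hm] at hn2
      push_cast at hn2
      linarith
    set y := (resolvent φ τ)^[i] x with hy
    have hyfin : φ y ≠ ∞ := iterate_ne_top hφ hτ x hi0
    have hyE : (φ y).toReal ≤ E := by
      have h := iterate_evi hφ hτ x hg i
      rw [← hy] at h
      have hle : i * τ * ((φ y).toReal - (φ g).toReal) ≤ ‖x - g‖ ^ 2 / 2 := by
        nlinarith [sq_nonneg ‖y - g‖]
      rw [hE, ← sub_le_iff_le_add', le_div_iff₀ (by positivity)]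
      rcases le_or_gt ((φ y).toReal - (φ g).toReal) 0 with hneg | hpos
      · nlinarith [sq_nonneg ‖x - g‖]
      · nlinarith
    have hspeed : ‖(resolvent φ τ)^[j] x - (resolvent φ τ)^[j + 1] x‖ ≤ τ * D := by
      have h := iterate_speed_le hφ hτ hyfin m
      rw [hy, ← Function.iterate_add_apply, ← Function.iterate_add_apply,
        show m + 1 + i = j + 1 by omega, show m + i = j by omega, ← hy] at h
      set d := ‖(resolvent φ τ)^[j] x - (resolvent φ τ)^[j + 1] x‖ with hd
      have h0 : 0 ≤ (φ ((resolvent φ τ)^[j] x)).toReal := ENNReal.toReal_nonneg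
      refine abs_le_of_sq_le_sq' ?_ (by positivity) |>.2
      rw [mul_pow, hD, Real.sq_sqrt (by positivity)]
      have h3 : m * d ^ 2 ≤ 2 * τ * E := h.trans (by gcongr; linarith)
      have h4 : a / 4 * d ^ 2 ≤ τ * (2 * τ * E) := by
        calc a / 4 * d ^ 2 ≤ m * τ * d ^ 2 := by gcongr
          _ = τ * (m * d ^ 2) := by ring
          _ ≤ _ := by gcongr
      have h5 : τ ^ 2 * (8 * E / a) = (τ * (2 * τ * E)) / (a / 4) := by
        field_simp
        ring
      rw [h5, le_div_iff₀ (by positivity)]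
      linarith
    have hjs : j ≤ ⌊s * 2 ^ n⌋₊ := Nat.floor_le_floor (by gcongr)
    have hst' : ⌊s * 2 ^ n⌋₊ ≤ ⌊t * 2 ^ n⌋₊ := Nat.floor_le_floor (by gcongr)
    obtain ⟨l, hl⟩ := Nat.exists_eq_add_of_le hst'
    unfold eulerScheme
    rw [hl]
    refine (norm_iterate_add_sub_le hφ hτ hspeed hjs l).trans_eq ?_
    push_cast
    ring
  refine ⟨D.toNNReal, LipschitzOnWith.of_dist_le_mul ?_⟩
  have key : ∀ s t, a ≤ s → s ≤ t → dist (flow φ t x) (flow φ s x) ≤ D * dist t s := by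
    intro s t has hst
    have hs : 0 ≤ s := ha.le.trans has
    have ht : 0 ≤ t := hs.trans hst
    rw [dist_eq_norm, Real.dist_eq, abs_of_nonneg (sub_nonneg.2 hst), mul_comm]
    refine le_of_tendsto_of_tendsto
      ((tendsto_eulerScheme hφ x ht).sub (tendsto_eulerScheme hφ x hs)).norm
      (((tendsto_floor_mul_two_pow ht).sub (tendsto_floor_mul_two_pow hs)).mul_const D) ?_
    filter_upwards [hbound] with n hn using hn s t has hst
  intro t ht s hs
  rw [Real.coe_toNNReal D (Real.sqrt_nonneg _)]
  rcases le_total s t with h | h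
  · exact key s t hs h
  · rw [dist_comm, dist_comm t s]
    exact key t s ht h

lemma flow_locallyLipschitzOn (x : H) : LocallyLipschitzOn (Ioi 0) fun t => flow φ t x := by
  intro t ht
  obtain ⟨K, hK⟩ := flow_lipschitz hφ x (half_pos ht)
  exact ⟨K, Ici (t / 2), mem_nhdsWithin_of_mem_nhds (Ici_mem_nhds (half_lt_self ht)), hK⟩

lemma tendsto_flow_zero (x : H) : Tendsto (fun t => flow φ t x) (𝓝[>] 0) (𝓝 x) := by
  rw [Metric.tendsto_nhds]
  intro ε hε
  obtain ⟨g, hg, hxg⟩ := Metric.mem_closure_iff.1 (hφ.dense x) (ε / 3) (by positivity)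
  have hlim : Tendsto (fun t : ℝ => (ε / 3) ^ 2 / 2 + t * (φ g).toReal) (𝓝[>] 0)
      (𝓝 ((ε / 3) ^ 2 / 2 + 0 * (φ g).toReal)) := by
    have : Continuous fun t : ℝ => (ε / 3) ^ 2 / 2 + t * (φ g).toReal := by fun_prop
    exact (this.tendsto 0).mono_left nhdsWithin_le_nhds
  have hlt : (ε / 3) ^ 2 / 2 + 0 * (φ g).toReal < (2 * (ε / 3)) ^ 2 / 2 := by nlinarith
  filter_upwards [hlim.eventually (gt_mem_nhds hlt), self_mem_nhdsWithin] with t ht ht0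
  have h := (flow_evi hφ x hg le_rfl ht0).2
  rw [flow_zero hφ, sub_zero] at h
  have h0 : 0 ≤ t * (φ (flow φ t x)).toReal := mul_nonneg (le_of_lt ht0) ENNReal.toReal_nonneg
  rw [dist_eq_norm] at hxg ⊢
  have h1 : ‖x - g‖ ^ 2 ≤ (ε / 3) ^ 2 := pow_le_pow_left₀ (norm_nonneg _) hxg.le 2
  have h2 : ‖flow φ t x - g‖ < 2 * (ε / 3) := by
    refine abs_lt_of_sq_lt_sq' ?_ (by positivity) |>.2
    linarith
  have := norm_sub_le_norm_sub_add_norm_sub (flow φ t x) g x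
  rw [norm_sub_rev g x] at this
  linarith

end Flow

/-- Divide the EVI by `t - s` and let `s` increase to `t`; the derivative of half the squared
distance to `z` is the required inner product. -/
lemma isSubgradient_of_evi {u : ℝ → H} {t : ℝ} {v : H} (hu : HasDerivAt u v t)
    (hfin : φ (u t) ≠ ∞)
    (h : ∀ z, φ z ≠ ∞ → ∀ᶠ s in 𝓝[<] t, ‖u t - z‖ ^ 2 / 2 + (t - s) * (φ (u t)).toReal
        ≤ ‖u s - z‖ ^ 2 / 2 + (t - s) * (φ z).toReal) :
    IsSubgradient φ (u t) (-v) := by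
  refine ⟨hfin, fun z hz => ?_⟩
  have hd : HasDerivAt (fun s => ‖u s - z‖ ^ 2 / 2) (inner ℝ (u t - z) v) t := by
    have := ((hu.sub_const z).norm_sq).div_const 2
    simpa using this
  have hs := (hasDerivAt_iff_tendsto_slope.1 hd).mono_left
    (nhdsWithin_mono t (show Iio t ⊆ {t}ᶜ from fun s hs => ne_of_lt hs))
  have hle : inner ℝ (u t - z) v ≤ (φ z).toReal - (φ (u t)).toReal := by
    refine le_of_tendsto hs ?_
    filter_upwards [h z hz, self_mem_nhdsWithin] with s hs hst
    have hpos : 0 < t - s := sub_pos.2 hst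
    rw [slope_comm, slope_def_field, div_le_iff₀ hpos]
    linarith
  have : inner ℝ (-v) (z - u t) = inner ℝ (u t - z) v := by
    rw [inner_neg_left, ← inner_neg_right, neg_sub, real_inner_comm]
  linarith

/-! ### Almost everywhere differentiability of Lipschitz curves. -/

lemma countable_of_orthonormal [SecondCountableTopology H] {w : Set H}
    (hw : Orthonormal ℝ ((↑) : w → H)) : w.Countable := by
  refine Set.PairwiseDisjoint.countable_of_isOpen (s := fun x => Metric.ball x (1 / 2))
    (fun x hx y hy hxy => ?_) (fun _ _ => Metric.isOpen_ball)
    (fun x _ => ⟨x, Metric.mem_ball_self (by norm_num)⟩)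
  refine Metric.ball_disjoint_ball ?_
  have hx1 : ‖x‖ = 1 := hw.1 ⟨x, hx⟩
  have hy1 : ‖y‖ = 1 := hw.1 ⟨y, hy⟩
  have hxy0 : inner ℝ x y = 0 := hw.2 (i := ⟨x, hx⟩) (j := ⟨y, hy⟩) (by simpa using hxy)
  have h : ‖x - y‖ ^ 2 = 2 := by
    rw [norm_sub_sq_real, hx1, hy1, hxy0]
    norm_num
  rw [dist_eq_norm]
  nlinarith [norm_nonneg (x - y)]

/-- Lipschitz curves in a separable Hilbert space are differentiable almost everywhere. -/
theorem ae_differentiableAt_of_lipschitzWith [CompleteSpace H] [SecondCountableTopology H]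
    {K : ℝ≥0} {u : ℝ → H} (hu : LipschitzWith K u) : ∀ᵐ t, DifferentiableAt ℝ u t := by
  obtain ⟨w, b, hb⟩ := exists_hilbertBasis ℝ H
  have hcount : Countable w := (countable_of_orthonormal (hb ▸ b.orthonormal)).to_subtype
  have hLip : ∀ i : w, LipschitzWith K fun t => inner ℝ (b i) (u t) := by
    intro i
    refine LipschitzWith.of_dist_le_mul fun s t => ?_
    rw [Real.dist_eq, ← inner_sub_right]
    refine (abs_real_inner_le_norm _ _).trans ?_
    rw [b.orthonormal.1 i, one_mul, ← dist_eq_norm]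
    exact hu.dist_le_mul s t
  set c : w → ℝ → ℝ := fun i => deriv fun t => inner ℝ (b i) (u t) with hc
  have hdiff : ∀ᵐ t, ∀ i : w, HasDerivAt (fun t => inner ℝ (b i) (u t)) (c i t) t := by
    rw [ae_all_iff]
    intro i
    filter_upwards [(hLip i).ae_differentiableAt_real] with t ht using ht.hasDerivAt
  -- Bessel's inequality for difference quotients, passed to the limit: the coordinate derivatives
  -- are square summable and assemble into a vector `v t`.
  have hbound : ∀ᵐ t, ∀ F : Finset w, ∑ i ∈ F, ‖c i t‖ ^ 2 ≤ (K : ℝ) ^ 2 := by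
    filter_upwards [hdiff] with t ht F
    have hlim : Tendsto (fun s => ∑ i ∈ F, ‖slope (fun t => inner ℝ (b i) (u t)) t s‖ ^ 2) (𝓝[≠] t)
        (𝓝 (∑ i ∈ F, ‖c i t‖ ^ 2)) :=
      tendsto_finsetSum _ fun i _ => ((hasDerivAt_iff_tendsto_slope.1 (ht i)).norm).pow 2
    refine le_of_tendsto hlim (Eventually.of_forall fun s => ?_)
    have he : ∀ i, slope (fun t => inner ℝ (b i) (u t)) t s = inner ℝ (b i) (slope u t s) := by
      intro i
      simp only [slope, vsub_eq_sub, inner_smul_right, inner_sub_right, smul_eq_mul]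
    simp only [he]
    refine (b.orthonormal.sum_inner_products_le (slope u t s)).trans ?_
    refine pow_le_pow_left₀ (norm_nonneg _) ?_ 2
    rw [slope, norm_smul, vsub_eq_sub, ← dist_eq_norm, norm_inv, ← dist_eq_norm, inv_mul_eq_div]
    exact div_le_of_le_mul₀ dist_nonneg K.2 (hu.dist_le_mul s t)
  set v : ℝ → H := fun t => ∑' i, c i t • b i with hv
  have hsum : ∀ᵐ t, HasSum (fun i => c i t • b i) (v t) ∧ (∀ i, inner ℝ (b i) (v t) = c i t)
      ∧ ‖v t‖ ≤ K := by
    filter_upwards [hbound] with t ht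
    have hmem : Memℓp (fun i => c i t) 2 := by
      refine memℓp_gen' (C := (K : ℝ) ^ 2) fun F => ?_
      simpa using ht F
    set d : lp (fun _ : w => ℝ) 2 := ⟨fun i => c i t, hmem⟩ with hd
    have hs : HasSum (fun i => c i t • b i) (b.repr.symm d) := b.hasSum_repr_symm d
    have hvd : v t = b.repr.symm d := hs.tsum_eq
    refine ⟨hvd ▸ hs, fun i => ?_, ?_⟩
    · rw [hvd, ← b.repr_apply_apply, LinearIsometryEquiv.apply_symm_apply]
    · rw [hvd, LinearIsometryEquiv.norm_map]
      refine lp.norm_le_of_forall_sum_le (by norm_num) K.2 fun F => ?_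
      simpa using ht F
  have hmeas : AEStronglyMeasurable v volume := by
    refine aestronglyMeasurable_of_tendsto_ae (u := (atTop : Filter (Finset w)))
      (f := fun F t => ∑ i ∈ F, c i t • b i) (fun F => ?_) (hsum.mono fun t ht => ht.1)
    refine Finset.aestronglyMeasurable_fun_sum F fun i _ => ?_
    exact ((measurable_deriv _).aestronglyMeasurable).smul aestronglyMeasurable_const
  have hint : LocallyIntegrable v volume := by
    refine (locallyIntegrable_const (K : ℝ)).mono hmeas ?_
    filter_upwards [hsum] with t ht
    exact ht.2.2.trans (le_abs_self _)
  have hii : ∀ s t, IntervalIntegrable v volume s t := fun s t =>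
    (hint.integrableOn_isCompact isCompact_uIcc).intervalIntegrable
  -- Checked coordinate by coordinate, where it is the theorem for real absolutely continuous
  -- functions; Lebesgue differentiation of the integral then finishes.
  have hFTC : ∀ t, u t = u 0 + ∫ s in (0 : ℝ)..t, v s := by
    intro t
    rw [← sub_eq_iff_eq_add']
    refine b.repr.injective (lp.ext (funext fun i => ?_))
    rw [b.repr_apply_apply, b.repr_apply_apply]
    have h1 : inner ℝ (b i) (∫ s in (0 : ℝ)..t, v s) = ∫ s in (0 : ℝ)..t, inner ℝ (b i) (v s) :=
      ((innerSL ℝ (b i)).intervalIntegral_comp_comm (hii 0 t)).symm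
    have h2 : ∫ s in (0 : ℝ)..t, inner ℝ (b i) (v s) = ∫ s in (0 : ℝ)..t, c i s := by
      refine intervalIntegral.integral_congr_ae ?_
      filter_upwards [hsum] with s hs _ using hs.2.1 i
    rw [h1, h2, inner_sub_right]
    exact ((hLip i).lipschitzOnWith.absolutelyContinuousOnInterval.integral_deriv_eq_sub).symm
  filter_upwards [LocallyIntegrable.ae_hasDerivAt_integral hint] with t ht
  have : u = fun t => u 0 + ∫ s in (0 : ℝ)..t, v s := funext hFTC
  rw [this]
  exact ((ht 0).const_add (u 0)).differentiableAt

/-! ### Uniqueness, existence and long-time limit of gradient flows. -/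

/-- `u` is, on `(0, ∞)`, a gradient flow of `φ` starting from `x`. -/
def IsGradientFlow (φ : H → ℝ≥0∞) (x : H) (u : ℝ → H) : Prop :=
  LocallyLipschitzOn (Ioi 0) u ∧
  (∀ᵐ t ∂(volume : Measure ℝ), 0 < t →
    ∃ v : H, HasDerivAt u v t ∧ IsSubgradient φ (u t) (-v)) ∧
  Tendsto u (𝓝[>] 0) (𝓝 x)

/-- The derivative of the squared distance is nonpositive almost everywhere by monotonicity, and
local Lipschitz continuity makes that distance absolutely continuous, so this can be integrated. -/
lemma IsGradientFlow.norm_sub_antitoneOn {x y : H} {u v : ℝ → H} (hu : IsGradientFlow φ x u)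
    (hv : IsGradientFlow φ y v) : AntitoneOn (fun t => ‖u t - v t‖ ^ 2) (Ioi 0) := by
  intro a ha b hb hab
  have hsub : Icc a b ⊆ Ioi 0 := fun t ht => lt_of_lt_of_le ha ht.1
  obtain ⟨K, hK⟩ := (hu.1.mono hsub).exists_lipschitzOnWith_of_compact isCompact_Icc
  obtain ⟨L, hL⟩ := (hv.1.mono hsub).exists_lipschitzOnWith_of_compact isCompact_Icc
  have hn : LipschitzOnWith (1 * (K + L)) (fun t => ‖u t - v t‖) (Icc a b) :=
    lipschitzWith_one_norm.comp_lipschitzOnWith (hK.sub hL)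
  rw [← uIcc_of_le hab] at hn
  have hac := hn.absolutelyContinuousOnInterval
  have hac2 : AbsolutelyContinuousOnInterval (fun t => ‖u t - v t‖ ^ 2) a b := by
    simpa only [sq] using hac.fun_mul hac
  have hd : ∫ t in a..b, deriv (fun t => ‖u t - v t‖ ^ 2) t ≤ 0 := by
    rw [intervalIntegral.integral_of_le hab]
    refine integral_nonpos_of_ae ?_
    rw [Filter.EventuallyLE, ae_restrict_iff' measurableSet_Ioc]
    filter_upwards [hu.2.1, hv.2.1] with t h1 h2 ht
    have ht0 : 0 < t := lt_trans ha ht.1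
    obtain ⟨u', hu', hus⟩ := h1 ht0
    obtain ⟨v', hv', hvs⟩ := h2 ht0
    have hder : HasDerivAt (fun t => ‖u t - v t‖ ^ 2) (2 * inner ℝ (u t - v t) (u' - v')) t :=
      (hu'.sub hv').norm_sq
    rw [hder.deriv]
    have hmon := hus.monotone hvs
    have he : inner ℝ (-u' - -v') (u t - v t) = - inner ℝ (u t - v t) (u' - v') := by
      rw [real_inner_comm, ← inner_neg_right]
      congr 1
      abel
    rw [he] at hmon
    rw [Pi.zero_apply]
    linarith
  rw [hac2.integral_deriv_eq_sub] at hd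
  simpa using hd

theorem IsGradientFlow.eqOn {x : H} {u v : ℝ → H} (hu : IsGradientFlow φ x u)
    (hv : IsGradientFlow φ x v) : EqOn v u (Ioi 0) := by
  intro t ht
  have hlim : Tendsto (fun s => ‖u s - v s‖ ^ 2) (𝓝[>] 0) (𝓝 0) := by
    have := ((hu.2.2.sub hv.2.2).norm).pow 2
    simpa using this
  have hle : ‖u t - v t‖ ^ 2 ≤ 0 := by
    refine ge_of_tendsto hlim ?_
    filter_upwards [Ioc_mem_nhdsGT (show (0 : ℝ) < t from ht)] with s hs
    exact hu.norm_sub_antitoneOn hv hs.1 ht hs.2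
  have h0 : ‖u t - v t‖ = 0 := by nlinarith [norm_nonneg (u t - v t)]
  exact (sub_eq_zero.1 (norm_eq_zero.1 h0)).symm

theorem isGradientFlow_flow [CompleteSpace H] [SecondCountableTopology H] (hφ : IsConvexLSC φ)
    (x : H) : IsGradientFlow φ x fun t => flow φ t x := by
  refine ⟨flow_locallyLipschitzOn hφ x, ?_, tendsto_flow_zero hφ x⟩
  have hdiff : ∀ n : ℕ, ∀ᵐ t : ℝ, 1 / ((n : ℝ) + 1) < t →
      DifferentiableAt ℝ (fun t => flow φ t x) t := by
    intro n
    have hpos : (0 : ℝ) < 1 / ((n : ℝ) + 1) := by positivity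
    obtain ⟨K, hK⟩ := flow_lipschitz hφ x hpos
    -- Freezing the curve before time `1 / (n + 1)` makes it globally Lipschitz without changing it
    -- near later times.
    have hLip : LipschitzWith (K * 1) fun t => flow φ (max t (1 / ((n : ℝ) + 1))) x := by
      rw [← lipschitzOnWith_univ]
      exact hK.comp ((LipschitzWith.id.max_const _).lipschitzOnWith) fun t _ => mem_Ici.2 (le_max_right _ _)
    filter_upwards [ae_differentiableAt_of_lipschitzWith hLip] with t ht hlt
    refine ht.congr_of_eventuallyEq ?_
    filter_upwards [Ioi_mem_nhds hlt] with s hs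
    rw [max_eq_left (le_of_lt hs)]
  filter_upwards [ae_all_iff.2 hdiff] with t ht ht0
  obtain ⟨n, hn⟩ := exists_nat_one_div_lt ht0
  refine ⟨_, (ht n hn).hasDerivAt, ?_⟩
  refine isSubgradient_of_evi (ht n hn).hasDerivAt ?_ fun z hz => ?_
  · have : Nonempty H := ⟨0⟩
    obtain ⟨g, hg⟩ : {x | φ x ≠ ∞}.Nonempty := hφ.dense.nonempty
    exact (flow_evi hφ x hg le_rfl ht0).1
  · filter_upwards [Ioo_mem_nhdsLT ht0] with s hs using (flow_evi hφ x hz hs.1.le hs.2).2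

/-- The flow of an even functional with minimum value `0` converges to a zero of the functional. -/
theorem exists_tendsto_flow_atTop [CompleteSpace H] (hφ : IsConvexLSC φ) (h0 : φ 0 = 0)
    (heven : ∀ x, φ (-x) = φ x) (x : H) :
    ∃ z, φ z = 0 ∧ Tendsto (fun t => flow φ t x) atTop (𝓝 z) := by
  have h0' : φ 0 ≠ ∞ := by simp [h0]
  -- Evenness enters here: the EVI tested at `-flow φ t x`, which has the same energy as `flow φ t
  -- x`, gives `‖2u(t)‖ ≤ ‖u(s) + u(t)‖`. The parallelogram law turns this into a Cauchy estimate
  -- governed by the decreasing norms.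
  have hstep : ∀ s t, 0 ≤ s → s < t →
      ‖flow φ s x - flow φ t x‖ ^ 2 ≤ 2 * (‖flow φ s x‖ ^ 2 - ‖flow φ t x‖ ^ 2) := by
    intro s t hs hst
    have hfin := (flow_evi hφ x h0' hs hst).1
    have h := (flow_evi hφ x (z := -flow φ t x) (by rwa [heven]) hs hst).2
    rw [heven, sub_neg_eq_add, sub_neg_eq_add, ← two_smul ℝ, norm_smul] at h
    have hp := parallelogram_law_with_norm ℝ (flow φ s x) (flow φ t x)
    norm_num at h
    nlinarith
  have hanti : AntitoneOn (fun t => ‖flow φ t x‖ ^ 2) (Ici 0) := by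
    intro s hs t ht hst
    rcases hst.eq_or_lt with rfl | hlt
    · exact le_rfl
    · have := hstep s t hs hlt
      simp only
      nlinarith [sq_nonneg ‖flow φ s x - flow φ t x‖]
  set e : ℝ → ℝ := fun t => ‖flow φ (max t 0) x‖ ^ 2 with he
  have heanti : Antitone e := fun s t hst =>
    hanti (mem_Ici.2 (le_max_right _ _)) (mem_Ici.2 (le_max_right _ _)) (max_le_max_right 0 hst)
  have hebdd : BddBelow (range e) := ⟨0, by rintro _ ⟨t, rfl⟩; positivity⟩
  set l := ⨅ t, e t with hl
  have hlim : Tendsto e atTop (𝓝 l) := tendsto_atTop_ciInf heanti hebdd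
  have hC : CauchySeq fun t => flow φ t x := by
    refine Metric.cauchySeq_iff'.2 fun ε hε => ?_
    have hlt : l < l + ε ^ 2 / 2 := by
      have : 0 < ε ^ 2 / 2 := by positivity
      linarith
    obtain ⟨T, hT, hT0⟩ := ((hlim.eventually (gt_mem_nhds hlt)).and (eventually_ge_atTop 0)).exists
    refine ⟨T, fun t ht => ?_⟩
    rcases ht.eq_or_lt with rfl | hTt
    · simpa using hε
    have h1 := hstep T t hT0 hTt
    have h2 : l ≤ e t := ciInf_le hebdd t
    simp only [he, max_eq_left hT0, max_eq_left (hT0.trans hTt.le)] at hT h2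
    rw [dist_comm, dist_eq_norm]
    exact abs_lt_of_sq_lt_sq' (by linarith) hε.le |>.2
  obtain ⟨z, hz⟩ := cauchySeq_tendsto_of_complete hC
  refine ⟨z, ?_, hz⟩
  -- The EVI tested at `0` gives energy at most `‖x‖² / (2t)`.
  have hdec : Tendsto (fun t : ℝ => ‖x‖ ^ 2 / 2 / t) atTop (𝓝 0) :=
    tendsto_const_nhds.div_atTop tendsto_id
  obtain ⟨h1, h2⟩ := hφ.toReal_le_of_tendsto hz hdec (by
    filter_upwards [eventually_gt_atTop 0] with t ht
    obtain ⟨h1, h2⟩ := flow_evi hφ x h0' le_rfl ht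
    refine ⟨h1, ?_⟩
    rw [le_div_iff₀ ht]
    rw [h0, flow_zero hφ, sub_zero, sub_zero, sub_zero] at h2
    simp only [ENNReal.toReal_zero, mul_zero, add_zero] at h2
    nlinarith [sq_nonneg ‖flow φ t x‖])
  have h3 : (φ z).toReal = 0 := le_antisymm h2 ENNReal.toReal_nonneg
  rw [ENNReal.toReal_eq_zero_iff] at h3
  exact h3.resolve_right h1

lemma eq_zero_of_flow_eq [CompleteSpace H] (hφ : IsConvexLSC φ) (h0 : φ 0 = 0) {x : H} {t : ℝ}
    (ht : 0 < t) (h : flow φ t x = x) : φ x = 0 := by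
  obtain ⟨h1, h2⟩ := flow_evi hφ x (z := 0) (by simp [h0]) le_rfl ht
  rw [h, flow_zero hφ, h0] at h2
  rw [h] at h1
  simp only [sub_zero, ENNReal.toReal_zero, mul_zero, add_zero] at h2
  have h3 : t * (φ x).toReal ≤ 0 := by linarith
  have h4 : (φ x).toReal = 0 :=
    le_antisymm (nonpos_of_mul_nonpos_right h3 ht) ENNReal.toReal_nonneg
  rw [ENNReal.toReal_eq_zero_iff] at h4
  exact h4.resolve_right h1

lemma isSubgradient_zero_iff (h0 : φ 0 = 0) {x : H} : IsSubgradient φ x 0 ↔ φ x = 0 := by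
  constructor
  · rintro ⟨h1, h2⟩
    have h3 := h2 0 (by simp [h0])
    rw [h0, inner_zero_left, zero_add] at h3
    have h4 : (φ x).toReal = 0 := le_antisymm (by simpa using h3) ENNReal.toReal_nonneg
    rw [ENNReal.toReal_eq_zero_iff] at h4
    exact h4.resolve_right h1
  · intro h
    refine ⟨by simp [h], fun y _ => ?_⟩
    simp [h]

lemma isGradientFlow_const {x : H} (h : IsSubgradient φ x 0) :
    IsGradientFlow φ x fun _ => x := by
  refine ⟨(LipschitzWith.const x).locallyLipschitz.locallyLipschitzOn,
    Eventually.of_forall fun t _ => ⟨0, hasDerivAt_const t x, by simpa using h⟩,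
    tendsto_const_nhds⟩

end ConvexFlow

namespace MetricMeasure

/-! ### Slopes of functions: subadditivity and measurability. -/

section Slope

variable {X : Type*} [MetricSpace X]

lemma slope_le_of_lipschitzWith {f : X → ℝ} {K : ℝ≥0} (hf : LipschitzWith K f) (x : X) :
    slope f x ≤ K := by
  refine limsup_le_of_le (by isBoundedDefault) (Eventually.of_forall fun y => ?_)
  exact ENNReal.div_le_of_le_mul (hf y x)

lemma slope_eq_zero_of_eventuallyEq {f : X → ℝ} {x : X} (hf : f =ᶠ[𝓝 x] 0) : slope f x = 0 := by
  have h : (fun y => edist (f y) (f x) / edist y x) =ᶠ[𝓝[≠] x] fun _ => 0 := by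
    filter_upwards [nhdsWithin_le_nhds hf] with y hy
    rw [hy, hf.self_of_nhds]
    simp
  rw [slope, limsup_congr h]
  exact limsup_const_bot

lemma edist_mul_left (a p q : ℝ) : edist (a * p) (a * q) = ‖a‖ₑ * edist p q := by
  rw [edist_eq_enorm_sub, edist_eq_enorm_sub, ← mul_sub, enorm_mul]

lemma slope_linear_combination_le (f g : X → ℝ) (a b : ℝ) (x : X) :
    slope (fun y => a * f y + b * g y) x ≤ ‖a‖ₑ * slope f x + ‖b‖ₑ * slope g x := by
  rw [slope, slope, slope, ← ENNReal.limsup_const_mul_of_ne_top enorm_ne_top,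
    ← ENNReal.limsup_const_mul_of_ne_top enorm_ne_top]
  refine ENNReal.le_of_forall_pos_le_add fun ε hε htop => ?_
  obtain ⟨h1, h2⟩ := ENNReal.add_lt_top.1 htop
  have hε2 : ((ε / 2 : ℝ≥0) : ℝ≥0∞) ≠ 0 := by
    have : (ε / 2 : ℝ≥0) ≠ 0 := (half_pos hε).ne'
    exact_mod_cast this
  refine limsup_le_of_le (by isBoundedDefault) ?_
  filter_upwards [eventually_lt_of_limsup_lt (ENNReal.lt_add_right h1.ne hε2),
    eventually_lt_of_limsup_lt (ENNReal.lt_add_right h2.ne hε2)] with y hy1 hy2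
  have h3 : edist (a * f y + b * g y) (a * f x + b * g x) / edist y x
      ≤ ‖a‖ₑ * (edist (f y) (f x) / edist y x) + ‖b‖ₑ * (edist (g y) (g x) / edist y x) := by
    rw [← mul_div_assoc, ← mul_div_assoc, ← ENNReal.add_div, ← edist_mul_left, ← edist_mul_left]
    gcongr
    exact edist_add_add_le _ _ _ _
  refine h3.trans ((add_le_add hy1.le hy2.le).trans_eq ?_)
  rw [add_add_add_comm, ← ENNReal.coe_add, add_halves]

/-- For fixed `y` the quotient is continuous in `x` off `y`, and `y` stays in the punctured ball
under small moves of `x`. Hence `measurable_slope` needs only a countable infimum over radii. -/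
lemma lowerSemicontinuous_iSup_quotient {f : X → ℝ} (hf : Continuous f) (r : ℝ) :
    LowerSemicontinuous fun x =>
      ⨆ y ∈ Metric.ball x r ∩ {x}ᶜ, edist (f y) (f x) / edist y x := by
  intro x a ha
  simp only [lt_iSup_iff] at ha
  obtain ⟨y, ⟨hyr, hyx⟩, hlt⟩ := ha
  have hyx' : y ≠ x := hyx
  have hcont : Tendsto (fun x' => edist (f y) (f x') / edist y x') (𝓝 x)
      (𝓝 (edist (f y) (f x) / edist y x)) := by
    refine ENNReal.Tendsto.div ?_ (Or.inr (edist_pos.2 hyx').ne') ?_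
      (Or.inl (edist_ne_top _ _))
    · exact (continuous_const.edist hf).tendsto x
    · exact (continuous_const.edist continuous_id).tendsto x
  have hball : ∀ᶠ x' in 𝓝 x, y ∈ Metric.ball x' r := by
    have : ∀ᶠ x' in 𝓝 x, x' ∈ Metric.ball y r :=
      Metric.isOpen_ball.mem_nhds (Metric.mem_ball_comm.1 hyr)
    filter_upwards [this] with x' hx' using Metric.mem_ball_comm.1 hx'
  filter_upwards [hcont.eventually (lt_mem_nhds hlt), hball, isOpen_ne.mem_nhds hyx'.symm]
    with x' h1 h2 h3
  exact h1.trans_le (le_iSup₂ (f := fun y _ => edist (f y) (f x') / edist y x') y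
    ⟨h2, fun h => h3 h.symm⟩)

lemma measurable_slope [MeasurableSpace X] [BorelSpace X] {f : X → ℝ} (hf : Continuous f) :
    Measurable (slope f) := by
  have h : slope f = fun x => ⨅ n : ℕ,
      ⨆ y ∈ Metric.ball x (1 / ((n : ℝ) + 1)) ∩ {x}ᶜ, edist (f y) (f x) / edist y x := by
    funext x
    rw [slope, ((nhdsWithin_hasBasis Metric.nhds_basis_ball_inv_nat_succ _).limsup_eq_iInf_iSup)]
    simp
  rw [h]
  exact Measurable.iInf fun n => (lowerSemicontinuous_iSup_quotient hf _).measurable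

end Slope

/-! ### Weak convergence: Mazur's lemma and sequential compactness. -/

section Weak

variable {E : Type*} [NormedAddCommGroup E] [NormedSpace ℝ E]

lemma mem_of_tendsto_weak {s : Set E} (hs : Convex ℝ s) (hc : IsClosed s) {ι : Type*}
    {l : Filter ι} [l.NeBot] {x : ι → E} {a : E} (hx : ∀ i, x i ∈ s)
    (h : ∀ L : E →L[ℝ] ℝ, Tendsto (fun i => L (x i)) l (𝓝 (L a))) : a ∈ s := by
  by_contra ha
  obtain ⟨L, r, h1, h2⟩ := geometric_hahn_banach_closed_point hs hc ha
  exact absurd h2 (not_lt.2 (le_of_tendsto (h L) (Eventually.of_forall fun i => (h1 _ (hx i)).le)))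

variable {H : Type*} [NormedAddCommGroup H] [InnerProductSpace ℝ H] [CompleteSpace H]

lemma clm_eq_inner (L : H →L[ℝ] ℝ) : ∃ h : H, ∀ x, L x = inner ℝ h x :=
  ⟨(InnerProductSpace.toDual ℝ H).symm L, fun x => by
    rw [InnerProductSpace.toDual_symm_apply]⟩

/-- Strong convergence in one factor and weak in the other give weak convergence of pairs, the mode
occurring in relaxed gradients. -/
lemma tendsto_clm_prod {ι : Type*} {l : Filter ι} {x : ι → E} {y : ι → H} {a : E} {b : H}
    (hx : Tendsto x l (𝓝 a))
    (hy : ∀ h : H, Tendsto (fun i => inner ℝ h (y i)) l (𝓝 (inner ℝ h b)))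
    (L : E × H →L[ℝ] ℝ) : Tendsto (fun i => L (x i, y i)) l (𝓝 (L (a, b))) := by
  have hL : ∀ p q, L (p, q) = L (p, 0) + L (0, q) := fun p q => by
    rw [← map_add, Prod.mk_add_mk, add_zero, zero_add]
  obtain ⟨h, hh⟩ := clm_eq_inner (L.comp (ContinuousLinearMap.inr ℝ E H))
  have hh' : ∀ q, L (0, q) = inner ℝ h q := fun q => hh q
  have he : (fun i => L (x i, y i)) = fun i => L (x i, 0) + inner ℝ h (y i) :=
    funext fun i => by rw [hL, hh']
  rw [he, hL a b, hh']
  have h1 : Continuous fun p : E => L (p, 0) := by fun_prop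
  exact ((h1.tendsto a).comp hx).add (hy h)

lemma exists_subseq_tendsto_weak [SecondCountableTopology H] {x : ℕ → H} {C : ℝ}
    (hx : ∀ n, ‖x n‖ ≤ C) : ∃ (a : H) (θ : ℕ → ℕ), StrictMono θ ∧
      ∀ h : H, Tendsto (fun n => inner ℝ h (x (θ n))) atTop (𝓝 (inner ℝ h a)) := by
  have hseq := WeakDual.isSeqCompact_closedBall ℝ H 0 C
  obtain ⟨a, -, θ, hθ, hlim⟩ := hseq
    (x := fun n => StrongDual.toWeakDual (InnerProductSpace.toDual ℝ H (x n))) (fun n => by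
      simpa using hx n)
  refine ⟨(InnerProductSpace.toDual ℝ H).symm (WeakDual.toStrongDual a), θ, hθ, fun h => ?_⟩
  have h1 := ((WeakDual.eval_continuous h).tendsto a).comp hlim
  have h2 : inner ℝ h ((InnerProductSpace.toDual ℝ H).symm (WeakDual.toStrongDual a)) = a h := by
    rw [real_inner_comm, InnerProductSpace.toDual_symm_apply]
    rfl
  rw [h2]
  refine h1.congr fun n => ?_
  simp only [Function.comp_apply]
  rw [real_inner_comm]
  rfl

end Weak

section Lp

variable {X : Type*} [MeasurableSpace X] {μ : Measure X}

lemma convex_nonneg_Lp : Convex ℝ {g : Lp ℝ 2 μ | 0 ≤ g} := by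
  intro p hp q hq a b ha hb _
  have hp' := (Lp.coeFn_nonneg p).2 hp
  have hq' := (Lp.coeFn_nonneg q).2 hq
  refine (Lp.coeFn_nonneg _).1 ?_
  filter_upwards [hp', hq', Lp.coeFn_add (a • p) (b • q), Lp.coeFn_smul a p,
      Lp.coeFn_smul b q] with x h1 h2 h3 h4 h5
  rw [h3, Pi.add_apply, h4, h5]
  simp only [Pi.smul_apply, smul_eq_mul, Pi.zero_apply] at *
  positivity

lemma lintegral_enorm_sq (G : Lp ℝ 2 μ) : ∫⁻ x, ‖G x‖ₑ ^ 2 ∂μ = ENNReal.ofReal (‖G‖ ^ 2) := by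
  have h := eLpNorm_nnreal_pow_eq_lintegral (f := G) (μ := μ) (p := 2) (by norm_num)
  have h2 : eLpNorm G 2 μ = ENNReal.ofReal ‖G‖ := by
    rw [Lp.norm_def, ENNReal.ofReal_toReal (Lp.eLpNorm_ne_top G)]
  rw [ENNReal.ofReal_pow (norm_nonneg _), ← h2]
  simpa using h.symm

end Lp

/-! ### Relaxed gradients as the closure of upper gradient pairs. -/

variable {X : Type*} [MetricSpace X] [MeasurableSpace X]

variable (μ : Measure X) in
/-- Pairs `(f, g)` such that `f` has a Lipschitz representative with slope at most `g`. -/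
def upperGradientPairs : Set (Lp ℝ 2 μ × Lp ℝ 2 μ) :=
  {p | ∃ u : X → ℝ, (∃ K : ℝ≥0, LipschitzWith K u) ∧ u =ᵐ[μ] p.1 ∧
    ∀ᵐ x ∂μ, (slope u x).toReal ≤ p.2 x}

variable {μ : Measure X}

lemma linear_combination_mem_upperGradientPairs {p q : Lp ℝ 2 μ × Lp ℝ 2 μ}
    (hp : p ∈ upperGradientPairs μ) (hq : q ∈ upperGradientPairs μ) (a b : ℝ) :
    (a • p.1 + b • q.1, |a| • p.2 + |b| • q.2) ∈ upperGradientPairs μ := by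
  obtain ⟨u, ⟨K, hK⟩, hu, hus⟩ := hp
  obtain ⟨v, ⟨L, hL⟩, hv, hvs⟩ := hq
  refine ⟨fun y => a * u y + b * v y,
    ⟨‖a‖₊ * K + ‖b‖₊ * L, ?_⟩, ?_, ?_⟩
  · exact ((lipschitzWith_smul a).comp hK).add ((lipschitzWith_smul b).comp hL)
  · filter_upwards [hu, hv, Lp.coeFn_add (a • p.1) (b • q.1), Lp.coeFn_smul a p.1,
      Lp.coeFn_smul b q.1] with x h1 h2 h3 h4 h5
    rw [h3, Pi.add_apply, h4, h5, h1, h2]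
    rfl
  · filter_upwards [hus, hvs, Lp.coeFn_add (|a| • p.2) (|b| • q.2), Lp.coeFn_smul |a| p.2,
      Lp.coeFn_smul |b| q.2] with x h1 h2 h3 h4 h5
    have hfu : slope u x ≠ ∞ :=
      ne_top_of_le_ne_top ENNReal.coe_ne_top (slope_le_of_lipschitzWith hK x)
    have hfv : slope v x ≠ ∞ :=
      ne_top_of_le_ne_top ENNReal.coe_ne_top (slope_le_of_lipschitzWith hL x)
    have h6 := ENNReal.toReal_mono (by finiteness) (slope_linear_combination_le u v a b x)
    rw [ENNReal.toReal_add (by finiteness) (by finiteness), ENNReal.toReal_mul, ENNReal.toReal_mul,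
      toReal_enorm, toReal_enorm, Real.norm_eq_abs, Real.norm_eq_abs] at h6
    rw [h3, Pi.add_apply, h4, h5]
    simp only [Pi.smul_apply, smul_eq_mul]
    refine h6.trans ?_
    gcongr

lemma convex_upperGradientPairs : Convex ℝ (upperGradientPairs μ) := by
  intro p hp q hq a b ha hb _
  have h := linear_combination_mem_upperGradientPairs hp hq a b
  rwa [abs_of_nonneg ha, abs_of_nonneg hb] at h

lemma zero_mem_upperGradientPairs : ((0, 0) : Lp ℝ 2 μ × Lp ℝ 2 μ) ∈ upperGradientPairs μ := by
  refine ⟨fun _ => 0, ⟨0, LipschitzWith.const 0⟩, ?_, ?_⟩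
  · filter_upwards [Lp.coeFn_zero ℝ 2 μ] with x hx
    exact hx.symm
  · filter_upwards [Lp.coeFn_zero ℝ 2 μ] with x hx
    have h0 : slope (fun _ : X => (0 : ℝ)) x = 0 :=
      slope_eq_zero_of_eventuallyEq (Eventually.of_forall fun _ => rfl)
    rw [h0, ENNReal.toReal_zero]
    exact hx.ge

/-- Adding the nonnegative gap `G - G'` to the slopes gives genuine pairs converging weakly to `(f,
G)`; a closed convex set contains weak limits. -/
lemma IsRelaxedGradient.mem_closure {f G : Lp ℝ 2 μ} (h : IsRelaxedGradient f G) :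
    (f, G) ∈ closure (upperGradientPairs μ) := by
  obtain ⟨u, hu, hs, G', hLip, hlim, hweak, hle⟩ := h
  refine mem_of_tendsto_weak (l := atTop) convex_upperGradientPairs.closure isClosed_closure
    (x := fun n => ((hu n).toLp (u n),
      (hs n).toLp (fun x => (slope (u n) x).toReal) + (G - G'))) (fun n => subset_closure ?_) ?_
  · refine ⟨u n, hLip n, (hu n).coeFn_toLp.symm, ?_⟩
    filter_upwards [Lp.coeFn_add ((hs n).toLp (fun x => (slope (u n) x).toReal)) (G - G'),
      Lp.coeFn_sub G G', (hs n).coeFn_toLp, hle] with x h1 h2 h3 h4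
    simp only [h1, h2, h3, Pi.add_apply, Pi.sub_apply]
    linarith
  · refine tendsto_clm_prod hlim fun h => ?_
    have h1 := (hweak h).add_const (inner ℝ h (G - G'))
    simp only [← inner_add_right] at h1
    simpa using h1

variable [BorelSpace X]

/-- The slopes are dominated by a convergent sequence, hence bounded, and a subsequence has a weak
limit `G'`. Weak closedness of the nonnegative cone gives `G' ≤ G`. -/
lemma isRelaxedGradient_of_mem_closure [SecondCountableTopology (Lp ℝ 2 μ)] {f G : Lp ℝ 2 μ}
    (h : (f, G) ∈ closure (upperGradientPairs μ)) : IsRelaxedGradient f G := by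
  obtain ⟨p, hp, hlim⟩ := mem_closure_iff_seq_limit.1 h
  choose u hLip hu hle using hp
  have hf : Tendsto (fun n => (p n).1) atTop (𝓝 f) := (continuous_fst.tendsto _).comp hlim
  have hg : Tendsto (fun n => (p n).2) atTop (𝓝 G) := (continuous_snd.tendsto _).comp hlim
  have hmem : ∀ n, MemLp (u n) 2 μ := fun n => (Lp.memLp (p n).1).ae_eq (hu n).symm
  have hle' : ∀ n, ∀ᵐ x ∂μ, ‖(slope (u n) x).toReal‖ ≤ ‖(p n).2 x‖ := fun n => by
    filter_upwards [hle n] with x hx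
    rw [Real.norm_of_nonneg ENNReal.toReal_nonneg]
    exact hx.trans (le_abs_self _)
  have hcont : ∀ n, Continuous (u n) := fun n => (hLip n).choose_spec.continuous
  have hsl : ∀ n, MemLp (fun x => (slope (u n) x).toReal) 2 μ := fun n =>
    (Lp.memLp (p n).2).mono (measurable_slope (hcont n)).ennreal_toReal.aestronglyMeasurable
      (hle' n)
  set S : ℕ → Lp ℝ 2 μ := fun n => (hsl n).toLp (fun x => (slope (u n) x).toReal) with hS
  obtain ⟨C, hC⟩ := hg.norm.bddAbove_range
  have hSC : ∀ n, ‖S n‖ ≤ C := fun n => by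
    refine le_trans (Lp.norm_le_norm_of_ae_le ?_) (hC ⟨n, rfl⟩)
    filter_upwards [(hsl n).coeFn_toLp, hle' n] with x h1 h2
    rwa [h1]
  obtain ⟨G', θ, hθ, hweak⟩ := exists_subseq_tendsto_weak hSC
  refine ⟨fun n => u (θ n), fun n => hmem _, fun n => hsl _, G', fun n => hLip _, ?_,
    hweak, ?_⟩
  · refine (hf.comp hθ.tendsto_atTop).congr fun n => ?_
    refine Lp.ext ?_
    exact (hu (θ n)).symm.trans (hmem _).coeFn_toLp.symm
  · have hnn : G - G' ∈ {g : Lp ℝ 2 μ | 0 ≤ g} := by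
      refine mem_of_tendsto_weak (l := atTop) convex_nonneg_Lp isClosed_Ici
        (x := fun n => (p (θ n)).2 - S (θ n)) (fun n => ?_) fun L => ?_
      · refine (Lp.coeFn_nonneg _).1 ?_
        filter_upwards [Lp.coeFn_sub (p (θ n)).2 (S (θ n)), (hsl (θ n)).coeFn_toLp, hle (θ n)]
          with x h1 h2 h3
        rw [h1, Pi.sub_apply, h2, Pi.zero_apply]
        linarith
      · obtain ⟨h, hh⟩ := clm_eq_inner L
        simp only [hh, inner_sub_right]
        exact (tendsto_const_nhds.inner (hg.comp hθ.tendsto_atTop)).sub (hweak h)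
    filter_upwards [(Lp.coeFn_nonneg _).2 hnn, Lp.coeFn_sub G G'] with x h1 h2
    rw [h2, Pi.sub_apply, Pi.zero_apply] at h1
    linarith

/-! ### Convexity and lower semicontinuity of the Cheeger energy. -/

section Energy

variable [SecondCountableTopology (Lp ℝ 2 μ)]

/-- The relaxed gradients of `f` form a slice of a closed convex set; project `0` onto it. -/
lemma IsRelaxedGradient.exists_isMinimal {f G : Lp ℝ 2 μ} (h : IsRelaxedGradient f G) :
    ∃ G₀, IsMinimalRelaxedGradient f G₀ := by
  set s : Set (Lp ℝ 2 μ) := {G | (f, G) ∈ closure (upperGradientPairs μ)} with hs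
  have hconv : Convex ℝ s := by
    intro p hp q hq a b ha hb hab
    have h := convex_upperGradientPairs.closure hp hq ha hb hab
    simpa [hs, ← add_smul, hab] using h
  have hclosed : IsClosed s := isClosed_closure.preimage (by fun_prop)
  obtain ⟨G₀, hG₀, hmin⟩ := exists_norm_eq_iInf_of_complete_convex ⟨G, h.mem_closure⟩
    hclosed.isComplete hconv 0
  refine ⟨G₀, isRelaxedGradient_of_mem_closure hG₀, fun G' hG' => ?_⟩
  simp only [zero_sub, norm_neg] at hmin
  rw [hmin]
  exact ciInf_le ⟨0, by rintro _ ⟨w, rfl⟩; exact norm_nonneg _⟩ (⟨G', hG'.mem_closure⟩ : s)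

omit [BorelSpace X] [SecondCountableTopology (Lp ℝ 2 μ)] in
lemma IsMinimalRelaxedGradient.cheegerEnergy_eq {f G : Lp ℝ 2 μ}
    (h : IsMinimalRelaxedGradient f G) : cheegerEnergy f = ENNReal.ofReal (‖G‖ ^ 2 / 2) := by
  have hex : ∃ G, IsMinimalRelaxedGradient f G := ⟨G, h⟩
  -- The energy is defined through a chosen minimiser, but all minimisers share one norm.
  have hn : ‖hex.choose‖ = ‖G‖ :=
    le_antisymm (hex.choose_spec.2 G h.1) (h.2 _ hex.choose_spec.1)
  rw [cheegerEnergy, dif_pos hex, lintegral_enorm_sq, hn, div_eq_inv_mul,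
    ENNReal.ofReal_mul (by norm_num), ENNReal.ofReal_inv_of_pos (by norm_num)]
  norm_num

lemma IsRelaxedGradient.cheegerEnergy_le {f G : Lp ℝ 2 μ} (h : IsRelaxedGradient f G) :
    cheegerEnergy f ≤ ENNReal.ofReal (‖G‖ ^ 2 / 2) := by
  obtain ⟨G₀, hG₀⟩ := h.exists_isMinimal
  rw [hG₀.cheegerEnergy_eq]
  have := hG₀.2 G h
  gcongr

omit [BorelSpace X] [SecondCountableTopology (Lp ℝ 2 μ)] in
lemma exists_isMinimal_of_ne_top {f : Lp ℝ 2 μ} (h : cheegerEnergy f ≠ ∞) :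
    ∃ G, IsMinimalRelaxedGradient f G := by
  by_contra hex
  rw [cheegerEnergy, dif_neg hex] at h
  exact h rfl

lemma cheegerEnergy_zero : cheegerEnergy (0 : Lp ℝ 2 μ) = 0 := by
  have h := (isRelaxedGradient_of_mem_closure
    (subset_closure (zero_mem_upperGradientPairs (μ := μ)))).cheegerEnergy_le
  simpa using h

lemma cheegerEnergy_neg_le (f : Lp ℝ 2 μ) : cheegerEnergy (-f) ≤ cheegerEnergy f := by
  by_cases h : cheegerEnergy f = ∞
  · rw [h]
    exact le_top
  obtain ⟨G, hG⟩ := exists_isMinimal_of_ne_top h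
  rw [hG.cheegerEnergy_eq]
  refine IsRelaxedGradient.cheegerEnergy_le (isRelaxedGradient_of_mem_closure ?_)
  have hcont : Continuous fun p : Lp ℝ 2 μ × Lp ℝ 2 μ => (-p.1, p.2) := by fun_prop
  refine map_mem_closure (f := fun p : Lp ℝ 2 μ × Lp ℝ 2 μ => (-p.1, p.2)) hcont
    hG.1.mem_closure fun p hp => ?_
  have := linear_combination_mem_upperGradientPairs hp hp (-1) 0
  simpa using this

lemma cheegerEnergy_neg (f : Lp ℝ 2 μ) : cheegerEnergy (-f) = cheegerEnergy f :=
  le_antisymm (cheegerEnergy_neg_le f) (by simpa using cheegerEnergy_neg_le (-f))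

lemma cheegerEnergy_convex (f g : Lp ℝ 2 μ) (hf : cheegerEnergy f ≠ ∞) (hg : cheegerEnergy g ≠ ∞)
    (a b : ℝ) (ha : 0 ≤ a) (hb : 0 ≤ b) (hab : a + b = 1) :
    cheegerEnergy (a • f + b • g) ≠ ∞ ∧ (cheegerEnergy (a • f + b • g)).toReal
      ≤ a * (cheegerEnergy f).toReal + b * (cheegerEnergy g).toReal := by
  obtain ⟨F, hF⟩ := exists_isMinimal_of_ne_top hf
  obtain ⟨G, hG⟩ := exists_isMinimal_of_ne_top hg
  have hmem : (a • f + b • g, a • F + b • G) ∈ closure (upperGradientPairs μ) :=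
    convex_upperGradientPairs.closure hF.1.mem_closure hG.1.mem_closure ha hb hab
  have h := (isRelaxedGradient_of_mem_closure hmem).cheegerEnergy_le
  rw [hF.cheegerEnergy_eq, hG.cheegerEnergy_eq, ENNReal.toReal_ofReal (by positivity),
    ENNReal.toReal_ofReal (by positivity)]
  refine ⟨ne_top_of_le_ne_top ENNReal.ofReal_ne_top h,
    (ENNReal.toReal_le_of_le_ofReal (by positivity) h).trans ?_⟩
  have hn : ‖a • F + b • G‖ ≤ a * ‖F‖ + b * ‖G‖ := by
    refine (norm_add_le _ _).trans_eq ?_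
    rw [norm_smul, norm_smul, Real.norm_of_nonneg ha, Real.norm_of_nonneg hb]
  have hn2 := pow_le_pow_left₀ (norm_nonneg _) hn 2
  have hb' : b = 1 - a := by linarith
  subst hb'
  nlinarith [mul_nonneg (mul_nonneg ha hb) (sq_nonneg (‖F‖ - ‖G‖))]

/-- On a sublevel the minimal gradients are bounded, so a subsequence converges weakly. The pairs
lie in a closed convex set that also encodes the norm bound, so the limit pair does too. -/
lemma lowerSemicontinuous_cheegerEnergy :
    LowerSemicontinuous (cheegerEnergy : Lp ℝ 2 μ → ℝ≥0∞) := by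
  rw [lowerSemicontinuous_iff_isClosed_preimage]
  intro y
  by_cases hy : y = ∞
  · simp [hy]
  refine IsSeqClosed.isClosed fun f f₀ hf hlim => ?_
  have hex : ∀ n, ∃ G, IsMinimalRelaxedGradient (f n) G := fun n =>
    exists_isMinimal_of_ne_top (ne_top_of_le_ne_top hy (hf n))
  choose G hG using hex
  have hbound : ∀ n, ‖G n‖ ≤ √(2 * y.toReal) := fun n => by
    have h := hf n
    rw [mem_preimage, mem_Iic, (hG n).cheegerEnergy_eq, ENNReal.ofReal_le_iff_le_toReal hy] at h
    refine Real.le_sqrt_of_sq_le ?_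
    linarith
  obtain ⟨G₀, θ, hθ, hweak⟩ := exists_subseq_tendsto_weak hbound
  set s : Set (Lp ℝ 2 μ × Lp ℝ 2 μ) := closure (upperGradientPairs μ) ∩
    (Prod.snd ⁻¹' Metric.closedBall 0 √(2 * y.toReal)) with hs
  have hconv : Convex ℝ s := convex_upperGradientPairs.closure.inter
    ((convex_closedBall 0 _).linear_preimage (LinearMap.snd ℝ (Lp ℝ 2 μ) (Lp ℝ 2 μ)))
  have hclosed : IsClosed s := isClosed_closure.inter (Metric.isClosed_closedBall.preimage
    continuous_snd)
  have hmem : (f₀, G₀) ∈ s := by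
    refine mem_of_tendsto_weak (l := atTop) hconv hclosed (x := fun n => (f (θ n), G (θ n)))
      (fun n => ⟨(hG _).1.mem_closure, by simpa using hbound (θ n)⟩)
      (tendsto_clm_prod (hlim.comp hθ.tendsto_atTop) hweak)
  have hle := (isRelaxedGradient_of_mem_closure hmem.1).cheegerEnergy_le
  refine hle.trans ?_
  rw [ENNReal.ofReal_le_iff_le_toReal hy]
  have h1 : ‖G₀‖ ≤ √(2 * y.toReal) := by simpa using hmem.2
  have h2 := pow_le_pow_left₀ (norm_nonneg _) h1 2
  rw [Real.sq_sqrt (by positivity)] at h2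
  linarith

end Energy

end MetricMeasure

/-! ### Density of the domain of the Cheeger energy. -/

namespace MetricMeasure

variable {X : Type*} [MetricSpace X] [MeasurableSpace X] {μ : Measure X}

variable (μ) in
/-- Functions with a Lipschitz representative whose slope is bounded by a function in `L²`. -/
def lipschitzSubmodule : Submodule ℝ (Lp ℝ 2 μ) where
  carrier := {f | ∃ g, (f, g) ∈ upperGradientPairs μ}
  zero_mem' := ⟨0, zero_mem_upperGradientPairs⟩
  add_mem' := by
    rintro f f' ⟨g, hg⟩ ⟨g', hg'⟩
    have h := linear_combination_mem_upperGradientPairs hg hg' 1 1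
    exact ⟨_, by simpa only [one_smul] using h⟩
  smul_mem' := by
    rintro c f ⟨g, hg⟩
    have h := linear_combination_mem_upperGradientPairs hg hg c 0
    exact ⟨_, by simpa only [zero_smul, add_zero] using h⟩

variable [BorelSpace X]

/-- The cutoff lies between the two indicators. Its slope is at most `1 / δ` and vanishes off the
closed thickening, hence is in `L²` because that set has finite measure. -/
lemma exists_cutoff_mem_lipschitzSubmodule {K : Set X} (hK : IsCompact K) {δ : ℝ} (hδ : 0 < δ)
    (hfin : μ (Metric.cthickening δ K) ≠ ∞) :
    ∃ f ∈ lipschitzSubmodule μ, ‖f - indicatorConstLp 2 hK.measurableSet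
        (measure_ne_top_of_subset (Metric.self_subset_cthickening K) hfin) (1 : ℝ)‖
      ≤ ‖indicatorConstLp 2 Metric.isClosed_cthickening.measurableSet hfin (1 : ℝ)
        - indicatorConstLp 2 hK.measurableSet
        (measure_ne_top_of_subset (Metric.self_subset_cthickening K) hfin) (1 : ℝ)‖ := by
  set u : X → ℝ := fun x => (thickenedIndicator hδ K x : ℝ) with hu
  have hLip : LipschitzWith (1 * δ.toNNReal⁻¹) u :=
    NNReal.isometry_coe.lipschitz.comp (lipschitzWith_thickenedIndicator hδ K)
  have hzero : ∀ x, x ∉ Metric.cthickening δ K → u x = 0 := fun x hx => by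
    simp only [hu]
    rw [thickenedIndicator_zero hδ K fun h => hx (Metric.thickening_subset_cthickening δ K h)]
    rfl
  have hle1 : ∀ x, u x ≤ 1 := fun x => thickenedIndicator_le_one hδ K x
  have hnn : ∀ x, 0 ≤ u x := fun x => NNReal.coe_nonneg _
  have hmT : MeasurableSet (Metric.cthickening δ K) := Metric.isClosed_cthickening.measurableSet
  have hmem : MemLp u 2 μ := by
    refine (memLp_indicator_const 2 hmT (1 : ℝ) (Or.inr hfin)).mono
      hLip.continuous.aestronglyMeasurable (Eventually.of_forall fun x => ?_)
    by_cases hx : x ∈ Metric.cthickening δ K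
    · rw [indicator_of_mem hx, Real.norm_of_nonneg (hnn x), norm_one]
      exact hle1 x
    · rw [hzero x hx, norm_zero]
      exact norm_nonneg _
  refine ⟨hmem.toLp u, ⟨indicatorConstLp 2 hmT hfin ((1 * δ.toNNReal⁻¹ : ℝ≥0) : ℝ), u,
    ⟨_, hLip⟩, hmem.coeFn_toLp.symm, ?_⟩, Lp.norm_le_norm_of_ae_le ?_⟩
  · filter_upwards [indicatorConstLp_coeFn (p := 2) (hs := hmT) (hμs := hfin)
      (c := ((1 * δ.toNNReal⁻¹ : ℝ≥0) : ℝ))] with x hx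
    rw [hx]
    by_cases hxT : x ∈ Metric.cthickening δ K
    · rw [indicator_of_mem hxT]
      exact ENNReal.toReal_mono ENNReal.coe_ne_top (slope_le_of_lipschitzWith hLip x)
    · rw [indicator_of_notMem hxT, slope_eq_zero_of_eventuallyEq, ENNReal.toReal_zero]
      filter_upwards [Metric.isClosed_cthickening.isOpen_compl.mem_nhds hxT] with y hy
        using hzero y hy
  · have hKfin : μ K ≠ ∞ :=
      measure_ne_top_of_subset (Metric.self_subset_cthickening K) hfin
    filter_upwards [Lp.coeFn_sub (hmem.toLp u) (indicatorConstLp 2 hK.measurableSet hKfin (1 : ℝ)),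
      Lp.coeFn_sub (indicatorConstLp 2 hmT hfin (1 : ℝ))
        (indicatorConstLp 2 hK.measurableSet hKfin (1 : ℝ)),
      hmem.coeFn_toLp, indicatorConstLp_coeFn (p := 2) (hs := hmT) (hμs := hfin) (c := (1 : ℝ)),
      indicatorConstLp_coeFn (p := 2) (hs := hK.measurableSet) (hμs := hKfin) (c := (1 : ℝ))]
      with x h1 h2 h3 h4 h5
    rw [h1, h2, Pi.sub_apply, Pi.sub_apply, h3, h4, h5]
    by_cases hxK : x ∈ K
    · have hx1 : u x = 1 := by
        simp only [hu]
        rw [thickenedIndicator_one hδ K hxK]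
        rfl
      rw [indicator_of_mem hxK, hx1, sub_self, norm_zero]
      exact norm_nonneg _
    · rw [indicator_of_notMem hxK, sub_zero, sub_zero]
      by_cases hxT : x ∈ Metric.cthickening δ K
      · rw [indicator_of_mem hxT, Real.norm_of_nonneg (hnn x), norm_one]
        exact hle1 x
      · rw [hzero x hxT, norm_zero]
        exact norm_nonneg _

lemma indicatorConstLp_compact_mem_closure (hμ : FiniteNearCompacts μ) {K : Set X}
    (hK : IsCompact K) (hfin : μ K ≠ ∞) :
    indicatorConstLp 2 hK.measurableSet hfin (1 : ℝ) ∈ (lipschitzSubmodule μ).topologicalClosure := by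
  obtain ⟨r, hr, hrfin⟩ := hμ K hK
  set δ : ℕ → ℝ := fun n => r * (1 / ((n : ℝ) + 1)) with hδ
  have hδpos : ∀ n, 0 < δ n := fun n => by positivity
  have hδle : ∀ n, δ n ≤ r := fun n => by
    refine mul_le_of_le_one_right hr.le ?_
    rw [div_le_one (by positivity)]
    linarith [Nat.cast_nonneg (α := ℝ) n]
  have hδ0 : Tendsto δ atTop (𝓝 0) := by
    simpa [hδ] using (tendsto_one_div_add_atTop_nhds_zero_nat (𝕜 := ℝ)).const_mul r
  have hTfin : ∀ n, μ (Metric.cthickening (δ n) K) ≠ ∞ := fun n =>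
    measure_ne_top_of_subset (Metric.cthickening_mono (hδle n) K) hrfin.ne
  choose f hfV hf using fun n => exists_cutoff_mem_lipschitzSubmodule hK (hδpos n) (hTfin n)
  have hT : Tendsto (fun n => μ (Metric.cthickening (δ n) K)) atTop (𝓝 (μ K)) :=
    (tendsto_measure_cthickening_of_isClosed ⟨r, hr, hrfin.ne⟩ hK.isClosed).comp hδ0
  have hsymm : Tendsto (fun n => μ (symmDiff (Metric.cthickening (δ n) K) K)) atTop (𝓝 0) := by
    have h1 := ENNReal.Tendsto.sub hT (tendsto_const_nhds (x := μ K)) (Or.inl hfin)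
    rw [tsub_self] at h1
    refine h1.congr fun n => ?_
    have hsub : K ⊆ Metric.cthickening (δ n) K := Metric.self_subset_cthickening K
    rw [symmDiff_of_ge hsub, measure_sdiff hsub hK.measurableSet.nullMeasurableSet hfin]
  have hind := tendsto_indicatorConstLp_set (p := 2) (c := (1 : ℝ)) (hs := hK.measurableSet)
    (hμs := hfin) (ht := fun n => (Metric.isClosed_cthickening (δ := δ n) (E := K)).measurableSet)
    (hμt := hTfin) (by norm_num) hsymm
  refine mem_closure_of_tendsto (f := f) (b := atTop) ?_ (Eventually.of_forall hfV)
  rw [tendsto_iff_norm_sub_tendsto_zero] at hind ⊢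
  exact squeeze_zero (fun _ => norm_nonneg _) hf hind

/-- Simple functions reduce the claim to indicators of sets of finite measure; inner regularity on a
complete separable space reduces these to compact sets. -/
lemma topologicalClosure_lipschitzSubmodule [CompleteSpace X] [SecondCountableTopology X]
    (hμ : FiniteNearCompacts μ) :
    (lipschitzSubmodule μ).topologicalClosure = ⊤ := by
  refine Submodule.eq_top_iff'.2 fun f => ?_
  refine Lp.induction (by norm_num)
    (fun f => f ∈ (lipschitzSubmodule μ).topologicalClosure) ?_ ?_ ?_ f
  · intro c s hs hμs
    rw [Lp.simpleFunc.coe_indicatorConst]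
    have hone : indicatorConstLp 2 hs hμs.ne (1 : ℝ)
        ∈ (lipschitzSubmodule μ).topologicalClosure := by
      have hex : ∀ n : ℕ, ∃ K ⊆ s, IsCompact K ∧ μ (s \ K) < ((n : ℝ≥0∞) + 1)⁻¹ := fun n =>
        hs.exists_isCompact_sdiff_lt hμs.ne (by simp)
      choose K hKs hK hKlt using hex
      have hKfin : ∀ n, μ (K n) ≠ ∞ := fun n => measure_ne_top_of_subset (hKs n) hμs.ne
      have hlim0 : Tendsto (fun n : ℕ => ((n : ℝ≥0∞) + 1)⁻¹) atTop (𝓝 0) := by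
        have := (tendsto_add_atTop_iff_nat 1).2 ENNReal.tendsto_inv_nat_nhds_zero
        simpa using this
      have hsymm : Tendsto (fun n => μ (symmDiff (K n) s)) atTop (𝓝 0) := by
        refine tendsto_of_tendsto_of_tendsto_of_le_of_le tendsto_const_nhds hlim0
          (fun _ => zero_le) fun n => ?_
        rw [symmDiff_of_le (hKs n)]
        exact (hKlt n).le
      have hind := tendsto_indicatorConstLp_set (p := 2) (c := (1 : ℝ)) (hs := hs)
        (hμs := hμs.ne) (ht := fun n => (hK n).measurableSet) (hμt := hKfin) (by norm_num) hsymm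
      exact (lipschitzSubmodule μ).isClosed_topologicalClosure.mem_of_tendsto hind
        (Eventually.of_forall fun n => indicatorConstLp_compact_mem_closure hμ (hK n) (hKfin n))
    have hc : indicatorConstLp 2 hs hμs.ne c = c • indicatorConstLp 2 hs hμs.ne (1 : ℝ) := by
      refine Lp.ext ?_
      filter_upwards [Lp.coeFn_smul c (indicatorConstLp 2 hs hμs.ne (1 : ℝ)),
        indicatorConstLp_coeFn (p := 2) (hs := hs) (hμs := hμs.ne) (c := (1 : ℝ)),
        indicatorConstLp_coeFn (p := 2) (hs := hs) (hμs := hμs.ne) (c := c)] with x h1 h2 h3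
      rw [h1, Pi.smul_apply, h2, h3]
      by_cases hx : x ∈ s <;> simp [hx]
    rw [hc]
    exact Submodule.smul_mem _ c hone
  · intro f g hf hg _ h1 h2
    exact Submodule.add_mem _ h1 h2
  · exact (lipschitzSubmodule μ).isClosed_topologicalClosure

/-! ### The Cheeger energy as an instance of the abstract theory. -/

variable [SecondCountableTopology (Lp ℝ 2 μ)]

lemma isConvexLSC_cheegerEnergy [CompleteSpace X] [SecondCountableTopology X]
    (hμ : FiniteNearCompacts μ) :
    ConvexFlow.IsConvexLSC (cheegerEnergy : Lp ℝ 2 μ → ℝ≥0∞) where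
  convex := cheegerEnergy_convex
  lsc := lowerSemicontinuous_cheegerEnergy
  dense := by
    have h : Dense (lipschitzSubmodule μ : Set (Lp ℝ 2 μ)) :=
      Submodule.dense_iff_topologicalClosure_eq_top.2 (topologicalClosure_lipschitzSubmodule hμ)
    refine h.mono ?_
    rintro f ⟨g, hg⟩
    exact ne_top_of_le_ne_top ENNReal.ofReal_ne_top
      (isRelaxedGradient_of_mem_closure (subset_closure hg)).cheegerEnergy_le

lemma mem_cheegerSubdifferential_iff {f ℓ : Lp ℝ 2 μ} :
    ℓ ∈ cheegerSubdifferential f ↔ ConvexFlow.IsSubgradient cheegerEnergy f ℓ := by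
  have hint : ∀ g : Lp ℝ 2 μ, ∫ x, ℓ x * (g x - f x) ∂μ = inner ℝ ℓ (g - f) := by
    intro g
    rw [L2.inner_def]
    refine integral_congr_ae ?_
    filter_upwards [Lp.coeFn_sub g f] with x hx
    rw [hx, Pi.sub_apply, real_inner_comm]
    rfl
  simp only [cheegerSubdifferential, mem_ofPred_eq, hint]
  constructor
  · intro h
    -- Testing at `g = 0`, where the energy vanishes, excludes infinite energy at `f`.
    have hfin : cheegerEnergy f ≠ ∞ := by
      intro htop
      have := h 0
      rw [htop, cheegerEnergy_zero] at this
      simp at this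
    refine ⟨hfin, fun g hg => ?_⟩
    have := h g
    rw [← EReal.coe_ennreal_toReal hfin, ← EReal.coe_ennreal_toReal hg] at this
    exact_mod_cast this
  · rintro ⟨hfin, h⟩ g
    by_cases hg : cheegerEnergy g = ∞
    · rw [hg]
      exact le_top
    · rw [← EReal.coe_ennreal_toReal hfin, ← EReal.coe_ennreal_toReal hg]
      exact_mod_cast h g hg

lemma isHeatFlow_iff {f : Lp ℝ 2 μ} {u : ℝ → Lp ℝ 2 μ} :
    IsHeatFlow f u ↔ ConvexFlow.IsGradientFlow cheegerEnergy f u := by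
  simp only [IsHeatFlow, ConvexFlow.IsGradientFlow, mem_cheegerSubdifferential_iff]

/-- Uniqueness makes the choice in `heatFlow` irrelevant, but only for `t > 0`. -/
lemma IsHeatFlow.heatFlow_eq {f : Lp ℝ 2 μ} {u : ℝ → Lp ℝ 2 μ} (hu : IsHeatFlow f u) {t : ℝ}
    (ht : 0 < t) : heatFlow t f = u t := by
  have hex : ∃ u, IsHeatFlow f u := ⟨u, hu⟩
  rw [heatFlow, dif_pos hex]
  exact (isHeatFlow_iff.1 hu).eqOn (isHeatFlow_iff.1 hex.choose_spec) ht

lemma hasLaplacian_zero_iff {f : Lp ℝ 2 μ} : HasLaplacian f 0 ↔ cheegerEnergy f = 0 := by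
  rw [HasLaplacian, mem_cheegerSubdifferential_iff,
    ConvexFlow.isSubgradient_zero_iff cheegerEnergy_zero]
  simp

omit [BorelSpace X] [SecondCountableTopology (Lp ℝ 2 μ)] in
lemma cheegerEnergy_eq_zero_iff {f : Lp ℝ 2 μ} :
    cheegerEnergy f = 0 ↔ ∃ G, IsMinimalRelaxedGradient f G ∧ ∀ᵐ x ∂μ, G x = 0 := by
  constructor
  · intro h
    obtain ⟨G, hG⟩ := exists_isMinimal_of_ne_top (f := f) (by simp [h])
    refine ⟨G, hG, ?_⟩
    rw [hG.cheegerEnergy_eq, ENNReal.ofReal_eq_zero] at h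
    have h0 : ‖G‖ = 0 := by nlinarith [norm_nonneg G]
    rw [norm_eq_zero.1 h0]
    exact Lp.coeFn_zero ℝ 2 μ
  · rintro ⟨G, hG, h0⟩
    have hG0 : G = 0 := (Lp.eq_zero_iff_ae_eq_zero).2 h0
    rw [hG.cheegerEnergy_eq, hG0]
    simp

end MetricMeasure

end

theorem proposition3p3 {X : Type*} [MetricSpace X] [CompleteSpace X]
    [TopologicalSpace.SeparableSpace X] [MeasurableSpace X] [BorelSpace X]
    (μ : Measure X) [SigmaFinite μ] (hμ : MetricMeasure.FiniteNearCompacts μ) :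
    -- the heat flow is well defined
    (∀ f : Lp ℝ 2 μ, ∃ u : ℝ → Lp ℝ 2 μ, MetricMeasure.IsHeatFlow f u ∧
      ∀ v : ℝ → Lp ℝ 2 μ, MetricMeasure.IsHeatFlow f v → EqOn v u (Ioi 0)) ∧
    List.TFAE [
      MetricMeasure.L2Liouville μ,
      ∀ f : Lp ℝ 2 μ, MetricMeasure.cheegerEnergy f = 0 → MetricMeasure.IsAEConst f,
      ∀ f G : Lp ℝ 2 μ, MetricMeasure.IsMinimalRelaxedGradient f G → (∀ᵐ x ∂μ, G x = 0) →
        MetricMeasure.IsAEConst f,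
      ∀ f : Lp ℝ 2 μ, ∃ g : Lp ℝ 2 μ, MetricMeasure.IsAEConst g ∧
        Tendsto (fun t : ℝ => MetricMeasure.heatFlow t f) atTop (𝓝 g),
      ∀ f : Lp ℝ 2 μ, (∀ t : ℝ, 0 < t → MetricMeasure.heatFlow t f = f) →
        MetricMeasure.IsAEConst f,
      ∀ f : Lp ℝ 2 μ, (∃ t₀ : ℝ, 0 < t₀ ∧ MetricMeasure.heatFlow t₀ f = f) →
        MetricMeasure.IsAEConst f] := by
  have : SecondCountableTopology X := UniformSpace.secondCountable_of_separable X
  -- Instance search needs this for second countability of `Lp ℝ 2 μ`, on which weak compactness and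
  -- differentiability rest.
  have : Fact ((2 : ℝ≥0∞) ≠ ∞) := ⟨by norm_num⟩
  have : SecondCountableTopology (Lp ℝ 2 μ) := inferInstance
  have hφ := MetricMeasure.isConvexLSC_cheegerEnergy hμ
  have hflow : ∀ f : Lp ℝ 2 μ, MetricMeasure.IsHeatFlow f
      fun t => ConvexFlow.flow MetricMeasure.cheegerEnergy t f := fun f =>
    MetricMeasure.isHeatFlow_iff.2 (ConvexFlow.isGradientFlow_flow hφ f)
  refine ⟨fun f => ⟨_, hflow f, fun v hv => (MetricMeasure.isHeatFlow_iff.1 (hflow f)).eqOn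
    (MetricMeasure.isHeatFlow_iff.1 hv)⟩, ?_⟩
  tfae_have 1 ↔ 2 := by
    simp only [MetricMeasure.L2Liouville, MetricMeasure.hasLaplacian_zero_iff]
  tfae_have 2 ↔ 3 := by
    simp only [MetricMeasure.cheegerEnergy_eq_zero_iff, forall_exists_index, and_imp]
  tfae_have 2 → 4 := by
    intro h f
    obtain ⟨g, hg, hlim⟩ := ConvexFlow.exists_tendsto_flow_atTop hφ
      MetricMeasure.cheegerEnergy_zero MetricMeasure.cheegerEnergy_neg f
    refine ⟨g, h g hg, hlim.congr' ?_⟩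
    filter_upwards [eventually_gt_atTop 0] with t ht using ((hflow f).heatFlow_eq ht).symm
  tfae_have 4 → 5 := by
    intro h f hf
    obtain ⟨g, hg, hlim⟩ := h f
    have hconst : Tendsto (fun t : ℝ => MetricMeasure.heatFlow t f) atTop (𝓝 f) := by
      refine tendsto_const_nhds.congr' ?_
      filter_upwards [eventually_gt_atTop 0] with t ht using (hf t ht).symm
    rwa [tendsto_nhds_unique hconst hlim]
  tfae_have 5 → 2 := by
    intro h f hf
    have hc : MetricMeasure.IsHeatFlow f fun _ => f :=
      MetricMeasure.isHeatFlow_iff.2 (ConvexFlow.isGradientFlow_const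
        ((ConvexFlow.isSubgradient_zero_iff MetricMeasure.cheegerEnergy_zero).2 hf))
    exact h f fun t ht => hc.heatFlow_eq ht
  tfae_have 6 → 5 := fun h f hf => h f ⟨1, one_pos, hf 1 one_pos⟩
  tfae_have 2 → 6 := by
    rintro h f ⟨t, ht, hft⟩
    rw [(hflow f).heatFlow_eq ht] at hft
    exact h f (ConvexFlow.eq_zero_of_flow_eq hφ MetricMeasure.cheegerEnergy_zero ht hft)
  tfae_finish
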